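/- Work on the complex-analytic projective line ${\bf P}^1$, with structure sheaf ${\cal O}={\cal O}_{{\bf P}^1}$ and line bundles ${\cal O}(w)$, $w\in{\bf Z}$. A vector bundle on ${\bf P}^1$ (a locally free sheaf of ${\cal O}$-modules of finite rank) is called pure of weight $w$ if it is semistable of slope $w$, i.e. isomorphic to a direct sum of finitely many copies of ${\cal O}(w)$. A mixed twistor structure is a vector bundle $E$ on ${\bf P}^1$ with a finite increasing filtration $W_\cdot E$ by strict subbundles (subsheaves $W_nE$ such that $W_nE$ and $E/W_nE$ are vector bundles) such that $W_nE/W_{n-1}E$ is pure of weight $n$ for every $n$. A mixed twistor complex is a complex $M^\cdot$ of sheaves of ${\cal O}$-modules on ${\bf P}^1$, indexed by ${\bf Z}$, with an increasing filtration $W^{\rm pre}_\cdot$ by subcomplexes which is finite in each degree (for every $i$ there are $a,b$ with $W^{\rm pre}_aM^i=0$ and $W^{\rm pre}_bM^i=M^i$), such that for all $i,n$ the cohomology sheaf $\underline{H}^i(Gr^{W^{\rm pre}}_n(M^\cdot))$ is locally free of finite rank and pure of weight $n+i$. Lemma. Let $(M^\cdot,W^{\rm pre}_\cdot)$ be a mixed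 twistor complex. Consider the spectral sequence of the filtered complex, which calculates the cohomology sheaves $\underline{H}^i(M^\cdot)$, numbered so that $E_1^{p,q}=Gr^{W^{\rm pre}}_{-p}(M^{p+q})$ with $d_1$ the differential induced by that of $M^\cdot$; thus $E_2^{p,q}=\underline{H}^{p+q}(Gr^{W^{\rm pre}}_{-p}(M^\cdot))$ and $d_r:E_r^{p,q}\to E_r^{p+r-1,q+2-r}$. It degenerates at $E_3$, i.e. $d_r=0$ for all $r\ge 3$. For every $i$ the cohomology sheaf $\underline{H}^i(M^\cdot)$ is a locally free sheaf of ${\cal O}$-modules of finite rank, and the filtration $$W_n\underline{H}^i(M^\cdot):=W^{\rm pre}_{n-i}\underline{H}^i(M^\cdot),\qquad W^{\rm pre}_m\underline{H}^i(M^\cdot):=\mathrm{im}\left(\underline{H}^i(W^{\rm pre}_mM^\cdot)\to\underline{H}^i(M^\cdot)\right),$$ is the weight filtration of a mixed twistor structure on $\underline{H}^i(M^\cdot)$. -/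

import Mathlib

open CategoryTheory CategoryTheory.Limits Opposite TopologicalSpace

noncomputable section

namespace Twistor

/-! ### Filtered objects and the spectral sequence of a filtered complex -/

section Filtered

variable {A : Type*} [Category* A] [Abelian A] {C : Type*} [Category* C] [Abelian C]

/-- The subquotient `F b / F a` of an increasing filtration, for `a ≤ b`. -/
def subquot {ι : Type*} [Preorder ι] {X : A} (F : ι →o Subobject X) {a b : ι} (h : a ≤ b) : A :=
  cokernel (Subobject.ofLE (F a) (F b) (F.monotone h))

/-- The canonical map `F b / F a ⟶ F b' / F a'` for `a ≤ a'` and `b ≤ b'`. -/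
def subquotMap {ι : Type*} [Preorder ι] {X : A} (F : ι →o Subobject X) {a b a' b' : ι}
    (h : a ≤ b) (h' : a' ≤ b') (ha : a ≤ a') (hb : b ≤ b') : subquot F h ⟶ subquot F h' :=
  cokernel.map _ _ (Subobject.ofLE _ _ (F.monotone ha)) (Subobject.ofLE _ _ (F.monotone hb))
    (by simp)

@[simp]
lemma subquotMap_id {ι : Type*} [Preorder ι] {X : A} (F : ι →o Subobject X) {a b : ι}
    (h : a ≤ b) : subquotMap F h h le_rfl le_rfl = 𝟙 _ := by
  unfold subquotMap subquot
  ext; simp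

@[simp]
lemma subquotMap_comp {ι : Type*} [Preorder ι] {X : A} (F : ι →o Subobject X)
    {a b a' b' a'' b'' : ι} (h : a ≤ b) (h' : a' ≤ b') (h'' : a'' ≤ b'')
    (ha : a ≤ a') (hb : b ≤ b') (ha' : a' ≤ a'') (hb' : b' ≤ b'') :
    subquotMap F h h' ha hb ≫ subquotMap F h' h'' ha' hb' =
      subquotMap F h h'' (ha.trans ha') (hb.trans hb') := by
  unfold subquotMap subquot
  ext; simp

lemma shortExact_cokernel_of_comp {X Y Z : A} (f : X ⟶ Y) (g : Y ⟶ Z) (h : X ⟶ Z)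
    (i : X ⟶ X) (j : Z ⟶ Z) (hi : i = 𝟙 X) (hj : j = 𝟙 Z) (hfg : f ≫ g = h) [Mono g]
    (w₁ : f ≫ g = i ≫ h) (w₂ : h ≫ j = f ≫ g)
    (w : cokernel.map f h i g w₁ ≫ cokernel.map h g f j w₂ = 0) :
    (ShortComplex.mk (cokernel.map f h i g w₁) (cokernel.map h g f j w₂) w).ShortExact := by
  subst hi hj hfg
  have hz : IsZero (kernelCokernelCompSequence.snakeInput f g).L₀.X₃ :=
    isZero_kernel_of_mono g
  have hm : Mono (kernelCokernelCompSequence.snakeInput f g).L₃.f :=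
    (kernelCokernelCompSequence.snakeInput f g).L₂'_exact.mono_g (hz.eq_of_src _ _)
  have he : Epi (cokernel.map (f ≫ g) g f (𝟙 _) w₂) :=
    haveI : Epi (cokernel.π (f ≫ g) ≫ cokernel.map (f ≫ g) g f (𝟙 _) w₂) := by
      simp only [cokernel.π_desc, cokernel.map, Category.id_comp]; infer_instance
    epi_of_epi (cokernel.π (f ≫ g)) _
  exact { exact := (kernelCokernelCompSequence.snakeInput f g).L₃_exact
          mono_f := hm
          epi_g := he }

lemma subquotMap_zero {ι : Type*} [Preorder ι] {X : A} (F : ι →o Subobject X)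
    {a b c : ι} (h : a ≤ b) (h' : b ≤ c) :
    subquotMap F h (h.trans h') le_rfl h' ≫ subquotMap F (h.trans h') h' h le_rfl = 0 := by
  unfold subquotMap subquot
  ext
  simp only [cokernel.map, cokernel.π_desc_assoc, Category.assoc, cokernel.π_desc, comp_zero,
    Subobject.ofLE_comp_ofLE_assoc]
  exact cokernel.condition _

/-- The short exact sequence `0 ⟶ F b / F a ⟶ F c / F a ⟶ F c / F b ⟶ 0` for `a ≤ b ≤ c`. -/
def subquotSC {ι : Type*} [Preorder ι] {X : A} (F : ι →o Subobject X) {a b c : ι}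
    (h : a ≤ b) (h' : b ≤ c) : ShortComplex A :=
  ShortComplex.mk (subquotMap F h (h.trans h') le_rfl h')
    (subquotMap F (h.trans h') h' h le_rfl) (subquotMap_zero F h h')

lemma subquotSC_shortExact {ι : Type*} [Preorder ι] {X : A} (F : ι →o Subobject X) {a b c : ι}
    (h : a ≤ b) (h' : b ≤ c) : (subquotSC F h h').ShortExact :=
  shortExact_cokernel_of_comp _ _ _ _ _ (Subobject.ofLE_refl _) (Subobject.ofLE_refl _)
    (Subobject.ofLE_comp_ofLE _ _ _ _ _) (by simp) (by simp) (subquotMap_zero F h h')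

/-- The functor `(a ≤ b) ↦ F b / F a`. -/
def subquotFunctor {ι : Type*} [Preorder ι] {X : A} (F : ι →o Subobject X) :
    ComposableArrows ι 1 ⥤ A where
  obj D := subquot F (leOfHom (D.map' 0 1))
  map φ := subquotMap F _ _ (leOfHom (φ.app 0)) (leOfHom (φ.app 1))

/-- Functoriality of the short exact sequences of subquotients. -/
def subquotSCMap {ι : Type*} [Preorder ι] {X : A} (F : ι →o Subobject X) {a b c a' b' c' : ι}
    (h₁ : a ≤ b) (h₂ : b ≤ c) (h₁' : a' ≤ b') (h₂' : b' ≤ c') (ha : a ≤ a') (hb : b ≤ b')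
    (hc : c ≤ c') : subquotSC F h₁ h₂ ⟶ subquotSC F h₁' h₂' where
  τ₁ := subquotMap F _ _ ha hb
  τ₂ := subquotMap F _ _ ha hc
  τ₃ := subquotMap F _ _ hb hc
  comm₁₂ := by dsimp only [subquotSC]; rw [subquotMap_comp, subquotMap_comp]
  comm₂₃ := by dsimp only [subquotSC]; rw [subquotMap_comp, subquotMap_comp]

attribute [local irreducible] subquot subquotMap in
set_option maxHeartbeats 1000000 in
/-- The spectral object of a filtered complex: `H n (a ≤ b)` is the cohomology object
`Hⁿ(F b M / F a M)`, and the connecting maps are those of the short exact sequences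
`0 ⟶ F b M / F a M ⟶ F c M / F a M ⟶ F c M / F b M ⟶ 0`. -/
def filteredSpectralObject {ι : Type*} [Preorder ι] {M : CochainComplex C ℤ}
    (F : ι →o Subobject M) : Abelian.SpectralObject C ι where
  H n := subquotFunctor F ⋙ HomologicalComplex.homologyFunctor C _ n
  δ' n₀ n₁ h :=
    { app D := (subquotSC_shortExact F (leOfHom (D.map' 0 1)) (leOfHom (D.map' 1 2))).δ n₀ n₁ h
      naturality D D' φ := (HomologicalComplex.HomologySequence.δ_naturality
        (subquotSCMap F (leOfHom (D.map' 0 1)) (leOfHom (D.map' 1 2)) (leOfHom (D'.map' 0 1))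
          (leOfHom (D'.map' 1 2)) (leOfHom (φ.app 0)) (leOfHom (φ.app 1)) (leOfHom (φ.app 2)))
        (subquotSC_shortExact F _ _) (subquotSC_shortExact F _ _) n₀ n₁ h).symm }
  exact₁' n₀ n₁ h D :=
    ((subquotSC_shortExact F (leOfHom (D.map' 0 1)) (leOfHom (D.map' 1 2))).homology_exact₁
      n₀ n₁ h).exact_toComposableArrows
  exact₂' n D :=
    ((subquotSC_shortExact F (leOfHom (D.map' 0 1)) (leOfHom (D.map' 1 2))).homology_exact₂
      n).exact_toComposableArrows
  exact₃' n₀ n₁ h D :=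
    ((subquotSC_shortExact F (leOfHom (D.map' 0 1)) (leOfHom (D.map' 1 2))).homology_exact₃
      n₀ n₁ h).exact_toComposableArrows

/-- The indexing of the spectral sequence of an increasingly filtered complex `(M, W)`, in the
convention `E₁^{p,q} = Gr_{-p} M^{p+q}`, with `d₁` the differential of `Gr M`, so that
`E₂^{p,q} = H^{p+q}(Gr_{-p} M)` and `d_r : E_r^{p,q} ⟶ E_r^{p+r-1,q+2-r}` for `r ≥ 2`.
The entry `E_r^{p,q}` is the image of `H^{p+q}(W_{-p} / W_{-p-r+1})` in
`H^{p+q}(W_{-p+r-2} / W_{-p-1})`. -/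
def weightCore : Abelian.SpectralObject.SpectralSequenceDataCore ℤ
    (fun r ↦ ComplexShape.up' ((r - 1, 2 - r) : ℤ × ℤ)) 2 where
  deg pq := pq.1 + pq.2
  i₀ r pq _ := -pq.1 - r + 1
  i₁ pq := -pq.1 - 1
  i₂ pq := -pq.1
  i₃ r pq _ := -pq.1 + r - 2
  le₀₁ r pq hr := by lia
  le₁₂ pq := by lia
  le₂₃ r pq hr := by lia
  hc := by rintro r pq _ rfl _; dsimp; lia
  hc₀₂ := by rintro r pq _ rfl _; dsimp; lia
  hc₁₃ := by rintro r pq _ rfl _; dsimp; lia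
  antitone_i₀ r r' pq hr hrr' := by lia
  monotone_i₃ r r' pq hr hrr' := by lia
  i₀_prev := by rintro r r' pq _ rfl _ _; dsimp; lia
  i₃_next := by rintro r r' pq _ rfl _ _; dsimp; lia

instance (E : Abelian.SpectralObject C ℤ) : E.HasSpectralSequence weightCore where
  isZero_H_obj_mk₁_i₀_le r r' pq hpq n hn hrr' hr := (hpq _ rfl).elim
  isZero_H_obj_mk₁_i₃_le r r' pq hpq n hn hrr' hr :=
    (hpq (pq - (r - 1, 2 - r)) (by simp)).elim

/-- The spectral sequence of the filtered complex `(M, W)`, from its page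
`E₂^{p,q} = H^{p+q}(Gr_{-p} M)` on; the differential `d_r` has bidegree `(r - 1, 2 - r)`. -/
def filteredSpectralSequence {M : CochainComplex C ℤ} (W : ℤ →o Subobject M) :
    SpectralSequence C (fun r ↦ ComplexShape.up' ((r - 1, 2 - r) : ℤ × ℤ)) 2 :=
  (filteredSpectralObject W).spectralSequence weightCore

/-- The graded piece `Gr_n = W_n / W_{n-1}` of an increasing filtration. -/
def gr {X : A} (W : ℤ →o Subobject X) (n : ℤ) : A :=
  subquot W (show n - 1 ≤ n by lia)

instance : (weightCore).HasFirstPageComputation where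
  hi₀₁ pq := by dsimp [weightCore]; lia
  hi₂₃ pq := by dsimp [weightCore]; lia

/-- The page `E₂` of the spectral sequence of a filtered complex:
`E₂^{p,q} = H^{p+q}(Gr_{-p} M)`. -/
def filteredSpectralSequenceE₂Iso {M : CochainComplex C ℤ} (W : ℤ →o Subobject M) (p q : ℤ) :
    ((filteredSpectralSequence W).page 2).X (p, q) ≅ (gr W (-p)).homology (p + q) :=
  (filteredSpectralObject W).spectralSequenceFirstPageXIso weightCore (p, q) (-p - 1) (-p)
    rfl rfl (p + q) rfl

/-- The filtration is finite in each degree: for every `i`, `W_a M^i = 0` for some `a` and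
`W_b M^i = M^i` for some `b`. -/
def IsDegreewiseFinite {M : CochainComplex C ℤ} (W : ℤ →o Subobject M) : Prop :=
  ∀ i : ℤ, (∃ a : ℤ, IsZero ((W a : CochainComplex C ℤ).X i)) ∧
    ∃ b : ℤ, IsIso ((W b).arrow.f i)

/-- The filtration induced on cohomology: `W_n Hⁱ(M)` is the image of `Hⁱ(W_n M) ⟶ Hⁱ(M)`. -/
def inducedFiltration {M : CochainComplex C ℤ} (W : ℤ →o Subobject M) (i : ℤ) :
    ℤ →o Subobject (M.homology i) where
  toFun n := imageSubobject (HomologicalComplex.homologyMap (W n).arrow i)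
  monotone' m n h := by
    have e : HomologicalComplex.homologyMap (W m).arrow i =
        HomologicalComplex.homologyMap (Subobject.ofLE _ _ (W.monotone h)) i ≫
          HomologicalComplex.homologyMap (W n).arrow i := by
      rw [← HomologicalComplex.homologyMap_comp, Subobject.ofLE_arrow]
    dsimp only
    rw [e]
    exact imageSubobject_comp_le _ _

/-- The shifted filtration `n ↦ W_{n-i}`. -/
def shiftFiltration {X : A} (W : ℤ →o Subobject X) (i : ℤ) : ℤ →o Subobject X where
  toFun n := W (n - i)
  monotone' _ _ h := W.monotone (by lia)

end Filtered

/-! ### The complex-analytic projective line -/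

/-- Nonzero vectors of `ℂ²`, with the subspace topology. -/
abbrev PuncturedPlane : Type := {v : ℂ × ℂ // v ≠ 0}

/-- The projective line over `ℂ`. -/
def ProjLine : Type := Projectivization ℂ (ℂ × ℂ)

/-- The quotient map `ℂ² ∖ {0} → ℙ¹`. -/
def proj (v : PuncturedPlane) : ProjLine := Projectivization.mk ℂ v.1 v.2

/-- The classical topology on `ℙ¹`: the quotient topology from `ℂ² ∖ {0}`. -/
instance : TopologicalSpace ProjLine := TopologicalSpace.coinduced proj inferInstance

/-- The inverse image in `ℂ² ∖ {0}` of an open subset of `ℙ¹`. -/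
abbrev Cone (U : Opens (TopCat.of ProjLine)) : Type := {v : PuncturedPlane // proj v ∈ U}

/-- The extension by zero to `ℂ²` of a function on the cone over `U`. -/
def extendByZero {U : Opens (TopCat.of ProjLine)} (f : Cone U → ℂ) : ℂ × ℂ → ℂ :=
  Function.extend (fun v : Cone U => (v.1.1 : ℂ × ℂ)) f 0

/-- The cone over `U`, as a subset of `ℂ²`. -/
def coneSet (U : Opens (TopCat.of ProjLine)) : Set (ℂ × ℂ) :=
  Set.range (fun v : Cone U => (v.1.1 : ℂ × ℂ))

/-- A function on the cone over `U` is holomorphic (the cone is open in `ℂ²`). -/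
def IsHolo {U : Opens (TopCat.of ProjLine)} (f : Cone U → ℂ) : Prop :=
  DifferentiableOn ℂ (extendByZero f) (coneSet U)

/-- The scalar `c ≠ 0` acts on the cone over `U`. -/
def Cone.smul {U : Opens (TopCat.of ProjLine)} (c : ℂˣ) (v : Cone U) : Cone U :=
  ⟨⟨c • v.1.1, (smul_ne_zero_iff_ne c).2 v.1.2⟩, by
    have : proj ⟨c • v.1.1, (smul_ne_zero_iff_ne c).2 v.1.2⟩ = proj v.1 :=
      (Projectivization.mk_eq_mk_iff ℂ _ _ _ _).2 ⟨c, rfl⟩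
    rw [this]; exact v.2⟩

/-- `f (c v) = c ^ n f v` for every nonzero scalar `c`. -/
def IsHomogeneous {U : Opens (TopCat.of ProjLine)} (n : ℤ) (f : Cone U → ℂ) : Prop :=
  ∀ (c : ℂˣ) (v : Cone U), f (v.smul c) = (c : ℂ) ^ n * f v

lemma extendByZero_apply {U : Opens (TopCat.of ProjLine)} (f : Cone U → ℂ) (v : Cone U) :
    extendByZero f v.1.1 = f v :=
  Function.Injective.extend_apply
    (fun _ _ h => Subtype.ext (Subtype.ext h)) f 0 v

lemma isHolo_of_eq {U : Opens (TopCat.of ProjLine)} {f : Cone U → ℂ} {F : ℂ × ℂ → ℂ}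
    (hF : DifferentiableOn ℂ F (coneSet U)) (h : ∀ v : Cone U, F v.1.1 = f v) : IsHolo f :=
  hF.congr (by rintro _ ⟨v, rfl⟩; rw [h]; exact extendByZero_apply f v)

/-- The regular functions on `U`: the holomorphic functions on the cone over `U` that are
constant along the lines, i.e. (pullbacks of) holomorphic functions on `U ⊆ ℙ¹`. -/
def regular (U : Opens (TopCat.of ProjLine)) : Subring (Cone U → ℂ) where
  carrier := {f | IsHolo f ∧ IsHomogeneous 0 f}
  mul_mem' {f g} hf hg := ⟨isHolo_of_eq (hf.1.mul hg.1)
      fun v => by simp [extendByZero_apply], fun c v => by simp [hf.2 c v, hg.2 c v]⟩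
  one_mem' := ⟨isHolo_of_eq (differentiableOn_const 1) fun v => rfl, fun c v => by simp⟩
  add_mem' {f g} hf hg := ⟨isHolo_of_eq (hf.1.add hg.1)
      fun v => by simp [extendByZero_apply], fun c v => by simp [hf.2 c v, hg.2 c v]⟩
  zero_mem' := ⟨isHolo_of_eq (differentiableOn_const 0) fun v => rfl, fun c v => by simp⟩
  neg_mem' {f} hf := ⟨isHolo_of_eq hf.1.neg
      fun v => by simp [extendByZero_apply], fun c v => by simp [hf.2 c v]⟩

/-- The sections of `𝒪(n)` over `U`: the holomorphic functions on the cone over `U` that are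
homogeneous of degree `n`. -/
def homogeneous (n : ℤ) (U : Opens (TopCat.of ProjLine)) :
    Submodule (regular U) (Cone U → ℂ) where
  carrier := {f | IsHolo f ∧ IsHomogeneous n f}
  add_mem' {f g} hf hg := ⟨isHolo_of_eq (hf.1.add hg.1)
      fun v => by simp [extendByZero_apply], fun c v => by simp [hf.2 c v, hg.2 c v, mul_add]⟩
  zero_mem' := ⟨isHolo_of_eq (differentiableOn_const 0) fun v => rfl, fun c v => by simp⟩
  smul_mem' r f hf := ⟨isHolo_of_eq (r.2.1.mul hf.1)
      fun v => by simp [extendByZero_apply, Subring.smul_def], fun c v => by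
        have h1 := r.2.2 c v
        have h2 := hf.2 c v
        simp only [zpow_zero, one_mul] at h1
        simp only [Subring.smul_def, smul_eq_mul, Pi.mul_apply, h1, h2]
        ring⟩

/-- The inclusion of cones. -/
def Cone.incl {U V : Opens (TopCat.of ProjLine)} (h : U ≤ V) (v : Cone U) : Cone V :=
  ⟨v.1, h v.2⟩

lemma IsHolo.restrict {U V : Opens (TopCat.of ProjLine)} (h : U ≤ V) {f : Cone V → ℂ}
    (hf : IsHolo f) : IsHolo (fun v => f (Cone.incl h v)) :=
  isHolo_of_eq (F := extendByZero f)
    (hf.mono (by rintro _ ⟨v, rfl⟩; exact ⟨Cone.incl h v, rfl⟩))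
    fun v => extendByZero_apply f (Cone.incl h v)

/-- Restriction of regular functions. -/
def regularRes {U V : Opens (TopCat.of ProjLine)} (h : U ≤ V) : regular V →+* regular U where
  toFun f := ⟨fun v => f.1 (Cone.incl h v), f.2.1.restrict h,
    fun c v => f.2.2 c (Cone.incl h v)⟩
  map_one' := rfl
  map_mul' _ _ := rfl
  map_zero' := rfl
  map_add' _ _ := rfl

/-- Restriction of sections of `𝒪(n)`. -/
def homogeneousRes (n : ℤ) {U V : Opens (TopCat.of ProjLine)} (h : U ≤ V) :
    homogeneous n V →ₛₗ[regularRes h] homogeneous n U where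
  toFun f := ⟨fun v => f.1 (Cone.incl h v), f.2.1.restrict h,
    fun c v => f.2.2 c (Cone.incl h v)⟩
  map_add' _ _ := rfl
  map_smul' _ _ := rfl

/-- The cone is open. -/
lemma isOpen_coneSet (U : Opens (TopCat.of ProjLine)) : IsOpen (coneSet U) := by
  have h1 : IsOpen (proj ⁻¹' (U : Set ProjLine)) := U.2.preimage continuous_coinduced_rng
  have h2 : coneSet U = Subtype.val '' (proj ⁻¹' (U : Set ProjLine)) := by
    ext x
    constructor
    · rintro ⟨v, rfl⟩; exact ⟨v.1, v.2, rfl⟩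
    · rintro ⟨v, hv, rfl⟩; exact ⟨⟨v, hv⟩, rfl⟩
  rw [h2]
  exact (isOpen_ne (x := (0 : ℂ × ℂ))).isOpenMap_subtype_val _ h1

/-- The gluing of compatible homogeneous holomorphic functions. -/
lemma exists_glue (n : ℤ) {ι : Type} (U : ι → Opens (TopCat.of ProjLine))
    (sf : ∀ i, homogeneous n (U i))
    (h : ∀ i j (v : PuncturedPlane) (hi : proj v ∈ U i) (hj : proj v ∈ U j),
      (sf i).1 ⟨v, hi⟩ = (sf j).1 ⟨v, hj⟩) :
    ∃! s : homogeneous n (iSup U), ∀ i, homogeneousRes n (le_iSup U i) s = sf i := by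
  have hex : ∀ v : Cone (iSup U), ∃ i, proj v.1 ∈ U i := fun v => Opens.mem_iSup.1 v.2
  choose k hk using hex
  let f : Cone (iSup U) → ℂ := fun v => (sf (k v)).1 ⟨v.1, hk v⟩
  have hf : ∀ i (v : Cone (U i)), f (Cone.incl (le_iSup U i) v) = (sf i).1 v :=
    fun i v => h _ _ _ _ _
  have hol : IsHolo f := by
    rintro _ ⟨v, rfl⟩
    have h1 : DifferentiableAt ℂ (extendByZero (sf (k v)).1) v.1.1 :=
      (sf (k v)).2.1.differentiableAt
        ((isOpen_coneSet _).mem_nhds ⟨⟨v.1, hk v⟩, rfl⟩)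
    refine (h1.congr_of_eventuallyEq ?_).differentiableWithinAt
    filter_upwards [(isOpen_coneSet (U (k v))).mem_nhds ⟨⟨v.1, hk v⟩, rfl⟩]
    rintro _ ⟨w, rfl⟩
    have e1 := extendByZero_apply (sf (k v)).1 w
    have e2 := extendByZero_apply f (Cone.incl (le_iSup U (k v)) w)
    exact e2.trans ((hf _ w).trans e1.symm)
  have hom : IsHomogeneous n f := fun c v => by
    have h1 := (sf (k v)).2.2 c ⟨v.1, hk v⟩
    have h2 := hf (k v) (Cone.smul c ⟨v.1, hk v⟩)
    exact h2.trans h1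
  refine ⟨⟨f, hol, hom⟩, fun i => Subtype.ext (funext fun v => hf i v), ?_⟩
  rintro s hs
  refine Subtype.ext (funext fun v => ?_)
  exact congrFun (congrArg Subtype.val (hs (k v))) ⟨v.1, hk v⟩

/-- The presheaf of rings `𝒪` on `ℙ¹`. -/
def structurePresheaf : (Opens (TopCat.of ProjLine))ᵒᵖ ⥤ RingCat.{0} where
  obj U := RingCat.of (regular U.unop)
  map i := RingCat.ofHom (regularRes i.unop.le)

/-- The presheaf of abelian groups underlying `𝒪(n)`. -/
def twistPresheafAb (n : ℤ) : (Opens (TopCat.of ProjLine))ᵒᵖ ⥤ AddCommGrpCat.{0} where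
  obj U := AddCommGrpCat.of (homogeneous n U.unop)
  map i := AddCommGrpCat.ofHom (homogeneousRes n i.unop.le).toAddMonoidHom

lemma isSheaf_twistPresheafAb (n : ℤ) : TopCat.Presheaf.IsSheaf (twistPresheafAb n) := by
  rw [TopCat.Presheaf.isSheaf_iff_isSheafUniqueGluing]
  intro ι U sf hsf
  exact exists_glue n U sf fun i j v hi hj =>
    congrFun (congrArg Subtype.val (hsf i j)) ⟨v, hi, hj⟩

lemma isSheaf_structurePresheaf : TopCat.Presheaf.IsSheaf structurePresheaf := by
  rw [TopCat.Presheaf.isSheaf_iff_isSheafUniqueGluing]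
  intro ι U sf hsf
  exact exists_glue 0 U sf fun i j v hi hj =>
    congrFun (congrArg Subtype.val (hsf i j)) ⟨v, hi, hj⟩

/-- The structure sheaf `𝒪` of the complex-analytic projective line. -/
def structureSheaf : Sheaf (Opens.grothendieckTopology (TopCat.of ProjLine)) RingCat.{0} :=
  ⟨structurePresheaf, isSheaf_structurePresheaf⟩

/-- The category of sheaves of `𝒪`-modules on `ℙ¹`. -/
abbrev Mods : Type 1 := SheafOfModules.{0} structureSheaf

/-- The presheaf of `𝒪`-modules `𝒪(n)`. -/
def twistPresheaf (n : ℤ) : PresheafOfModules.{0} structureSheaf.obj where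
  obj U := ModuleCat.of (regular U.unop) (homogeneous n U.unop)
  map i := ModuleCat.ofHom (Y := (ModuleCat.restrictScalars (regularRes i.unop.le)).obj
      (ModuleCat.of (regular _) (homogeneous n _)))
    { toFun := homogeneousRes n i.unop.le
      map_add' := fun _ _ => rfl
      map_smul' := fun _ _ => rfl }
  map_id _ := rfl
  map_comp _ _ := rfl

/-- The line bundle `𝒪(n)` on `ℙ¹`. -/
def twist (n : ℤ) : Mods := ⟨twistPresheaf n, isSheaf_twistPresheafAb n⟩

/-! ### Mixed twistor structures and mixed twistor complexes -/

instance : HasFiniteBiproducts Mods := Abelian.hasFiniteBiproducts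

/-- Locally free of finite rank: there are an open cover of `ℙ¹` and finitely many sections over
each member of it which form a basis there. -/
def IsVectorBundle (E : Mods) : Prop :=
  ∃ q : SheafOfModules.LocalGeneratorsData.{0} E, q.IsLocallyFreeData ∧ q.IsFiniteType

/-- Pure of weight `w`: isomorphic to a direct sum of finitely many copies of `𝒪(w)`. -/
def IsPure (E : Mods) (w : ℤ) : Prop :=
  ∃ m : ℕ, Nonempty (E ≅ ⨁ fun _ : Fin m => twist w)

/-- A strict subbundle of `E`: a subsheaf which is a vector bundle, as is its quotient. -/
def IsStrictSubbundle {E : Mods} (S : Subobject E) : Prop :=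
  IsVectorBundle (S : Mods) ∧ IsVectorBundle (cokernel S.arrow)

/-- `(E, W)` is a mixed twistor structure: `E` is a vector bundle on `ℙ¹` and `W` is a finite
increasing filtration by strict subbundles with `Gr_n` pure of weight `n` for all `n`. -/
structure IsMixedTwistorStructure (E : Mods) (W : ℤ →o Subobject E) : Prop where
  isVectorBundle : IsVectorBundle E
  strict : ∀ n, IsStrictSubbundle (W n)
  eventually_zero : ∃ a, IsZero (W a : Mods)
  eventually_all : ∃ b, W b = ⊤
  pure : ∀ n, IsPure (gr W n) n

/-- `(M, W)` is a mixed twistor complex: a complex of `𝒪`-modules on `ℙ¹` with an increasing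
filtration by subcomplexes, finite in each degree, such that `Hⁱ(Gr_n M)` is locally free of
finite rank and pure of weight `n + i` for all `n` and `i`. -/
structure IsMixedTwistorComplex (M : CochainComplex Mods ℤ) (W : ℤ →o Subobject M) : Prop where
  finite : IsDegreewiseFinite W
  isVectorBundle : ∀ n i : ℤ, IsVectorBundle ((gr W n).homology i)
  pure : ∀ n i : ℤ, IsPure ((gr W n).homology i) (n + i)

end Twistor

end

/-!
The differentials of the spectral sequence of a filtered complex decrease weights from the page
`E₃` on. The entry `E₂^{p,q} = H^{p+q}(Gr_{-p} M)` is pure of weight `-p + (p + q) = q`, and `d₂`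
preserves `q`, so `E₃^{p,q}` is the homology of a complex of sheaves which are pure of the same
weight `q`. Pure sheaves of weight `q` are stable under homology: by Liouville's theorem every
nonzero endomorphism of `𝒪(q)` is invertible, so that Gaussian elimination splits every morphism
between finite powers of `𝒪(q)` (`IsFinitePower.exists_normal_form`, `IsFinitePower.homology`).
For `r ≥ 3` the differential `d_r` maps an object of weight `q` to one of weight `q + 2 - r < q`,
and it vanishes because there are no nonzero morphisms `𝒪(a) ⟶ 𝒪(b)` for `b < a`
(`twist_hom_eq_zero`). The induction on `r` is `page_weight`.

The filtration being finite in each degree, `Gr_m Hⁿ(M)` is the entry `E_r^{-m,n+m}` for `r` large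
(`exists_gr_inducedFiltration_iso_page`): the entries of `E_r` are the images of maps
`Hⁿ(W_m / W_{m-r+1}) ⟶ Hⁿ(W_{m+r-2} / W_{m-1})`, where for `r` large the source receives an
epimorphism from `Hⁿ(W_m)` and the target is a subobject of `Hⁿ(M / W_{m-1})`. Hence `Gr_m Hⁿ(M)`
is pure of weight `n + m`.

The terms of the induced filtration and their quotients are iterated extensions of these graded
pieces, so it remains to see that vector bundles are stable under extensions
(`isVectorBundle_of_shortExact`). A sheaf of modules is a vector bundle if and only if it has local
frames (`isVectorBundle_of_frames`, `IsVectorBundle.exists_frame`), and in an extension a frame of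
the quotient lifts locally, as epimorphisms of sheaves of modules are locally surjective
(`exists_local_lift_of_epi`); together with a frame of the subsheaf, it is a frame of the extension.

Morphisms `𝒪(a) ⟶ 𝒪(b)` are multiplications by holomorphic functions on `ℂ² ∖ {0}` which are
homogeneous of degree `b - a` (`exists_multiplier`). Restricted to an affine line which avoids the
origin, such a function is entire and has a limit at infinity if `b ≤ a`, so that it is constant
there (`eq_of_homogeneous`).
-/

/-! ### Finite powers of an object whose nonzero endomorphisms are invertible -/

namespace Twistor

section FinitePower

open ZeroObject

variable {C : Type*} [Category* C] [Abelian C]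

/-- The finite direct sums of copies of `T`, as an inductive predicate. -/
inductive IsFinitePower (T : C) : C → Prop
  | zero {X : C} (h : IsZero X) : IsFinitePower T X
  | succ {X Y : C} (e : X ≅ T ⊞ Y) (h : IsFinitePower T Y) : IsFinitePower T X

namespace IsFinitePower

variable {T : C}

lemma of_iso {X Y : C} (h : IsFinitePower T X) (e : Y ≅ X) : IsFinitePower T Y := by
  cases h with
  | zero h => exact .zero (h.of_iso e)
  | succ e' h => exact .succ (e ≪≫ e') h

section

variable [HasFiniteBiproducts C]

/-- `⨁_{Fin (m + 1)} T ≅ T ⊞ ⨁_{Fin m} T`. -/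
noncomputable def biproductFinSuccIso (T : C) (m : ℕ) :
    (⨁ fun _ : Fin (m + 1) => T) ≅ T ⊞ (⨁ fun _ : Fin m => T) where
  hom := biprod.lift (biproduct.π _ 0) (biproduct.lift fun i => biproduct.π _ i.succ)
  inv := biprod.desc (biproduct.ι (fun _ : Fin (m + 1) => T) 0)
    (biproduct.desc fun i => biproduct.ι (fun _ : Fin (m + 1) => T) i.succ)
  hom_inv_id := by
    refine (biprod.lift_desc ..).trans ?_
    rw [biproduct.lift_desc, ← biproduct.total, Fin.sum_univ_succ]
  inv_hom_id := by
    ext i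
    · simp
    · rename_i i
      simp [biproduct.ι_π_ne _ (Fin.succ_ne_zero i).symm]
    · simp [biproduct.ι_π_ne _ (Fin.succ_ne_zero i)]
    · rename_i j
      by_cases h : i = j
      · subst h; simp
      · simp [biproduct.ι_π_ne _ h, biproduct.ι_π_ne _ (fun h' => h (Fin.succ_injective _ h'))]

lemma biproduct (T : C) (m : ℕ) : IsFinitePower T (⨁ fun _ : Fin m => T) := by
  induction m with
  | zero => exact .zero ((IsZero.iff_id_eq_zero _).2 (by ext j; exact j.elim0))
  | succ m ih => exact .succ (biproductFinSuccIso T m) ih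

lemma iff_exists_iso {X : C} :
    IsFinitePower T X ↔ ∃ m : ℕ, Nonempty (X ≅ ⨁ fun _ : Fin m => T) := by
  constructor
  · intro h
    induction h with
    | zero h =>
      exact ⟨0, ⟨h.iso ((IsZero.iff_id_eq_zero _).2 (by ext j; exact j.elim0))⟩⟩
    | succ e _ ih =>
      obtain ⟨m, ⟨e'⟩⟩ := ih
      exact ⟨m + 1, ⟨e ≪≫ biprod.mapIso (Iso.refl _) e' ≪≫ (biproductFinSuccIso T m).symm⟩⟩
  · rintro ⟨m, ⟨e⟩⟩
    exact (biproduct T m).of_iso e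

end

variable (hT : ∀ f : T ⟶ T, f ≠ 0 → IsIso f)
include hT

/-- If every nonzero endomorphism of `T` is invertible, a nonzero morphism `T ⟶ Y` to a finite
power of `T` is the inclusion of a direct factor whose complement is a finite power. -/
lemma exists_iso_of_ne_zero {Y : C} (hY : IsFinitePower T Y) (g : T ⟶ Y) (hg : g ≠ 0) :
    ∃ (Y' : C) (e : Y ≅ T ⊞ Y'), IsFinitePower T Y' ∧ g ≫ e.hom = biprod.inl := by
  induction hY with
  | zero h => exact (hg (h.eq_of_tgt _ _)).elim
  | @succ Y Y' e h ih =>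
    by_cases ha : g ≫ e.hom ≫ biprod.fst = 0
    · have hb : g ≫ e.hom ≫ biprod.snd ≠ 0 := fun hb => hg (by
        rw [← cancel_mono e.hom]; ext <;> simp [ha, hb])
      obtain ⟨Y'', e', h', he'⟩ := ih _ hb
      -- The component along the first factor vanishes: split `T` off the second factor, and swap.
      refine ⟨T ⊞ Y'', e ≪≫ biprod.mapIso (Iso.refl _) e' ≪≫ (biprod.associator _ _ _).symm ≪≫
        biprod.mapIso (biprod.braiding _ _) (Iso.refl _) ≪≫ biprod.associator _ _ _,
        .succ (Iso.refl _) h', ?_⟩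
      have h1 : g ≫ e.hom = (biprod.inl ≫ e'.inv) ≫ biprod.inr := by
        rw [← he']; ext <;> simp [ha]
      simp only [Iso.trans_hom, reassoc_of% h1]
      ext <;> simp
    · have := hT _ ha
      have h1 : g ≫ e.hom ≫ biprod.fst ≫ inv (g ≫ e.hom ≫ biprod.fst) = 𝟙 T := by
        simpa only [Category.assoc] using IsIso.hom_inv_id (g ≫ e.hom ≫ biprod.fst)
      -- The component along the first factor is invertible: `T` is embedded as a graph over it.
      refine ⟨Y', e ≪≫
        { hom := biprod.lift (biprod.fst ≫ inv (g ≫ e.hom ≫ biprod.fst))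
            (biprod.snd - biprod.fst ≫ inv (g ≫ e.hom ≫ biprod.fst) ≫ g ≫ e.hom ≫ biprod.snd)
          inv := biprod.desc (g ≫ e.hom) biprod.inr
          hom_inv_id := ?_
          inv_hom_id := ?_ }, h, ?_⟩
      · ext <;> simp
      · ext <;> simp [h1, reassoc_of% h1]
      · ext <;> simp [h1, reassoc_of% h1]

/-- The rank normal form of a morphism between finite powers of `T`: up to isomorphisms, it is the
identity of a direct factor `A`, extended by zero. -/
lemma exists_normal_form {X Y : C} (hX : IsFinitePower T X) (hY : IsFinitePower T Y)
    (f : X ⟶ Y) : ∃ (A B D : C) (e : X ≅ A ⊞ B) (e' : Y ≅ A ⊞ D), IsFinitePower T B ∧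
      IsFinitePower T D ∧ f = e.hom ≫ biprod.fst ≫ biprod.inl ≫ e'.inv := by
  induction hX generalizing Y with
  | @zero X h =>
    refine ⟨(0 : C), X, Y, ⟨biprod.inr, biprod.snd, by simp, by ext; simp⟩,
      ⟨biprod.inr, biprod.snd, by simp, by ext; simp⟩, .zero h, hY, h.eq_of_src _ _⟩
  | @succ X X' e h ih =>
    by_cases hg : biprod.inl ≫ e.inv ≫ f = 0
    · obtain ⟨A, B, D, e₁, e₂, hB, hD, hf⟩ := ih hY (biprod.inr ≫ e.inv ≫ f)
      refine ⟨A, T ⊞ B, D, e ≪≫ biprod.mapIso (Iso.refl _) e₁ ≪≫ (biprod.associator _ _ _).symm ≪≫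
        biprod.mapIso (biprod.braiding _ _) (Iso.refl _) ≪≫ biprod.associator _ _ _, e₂,
        .succ (Iso.refl _) hB, hD, ?_⟩
      rw [← cancel_epi e.inv]
      ext
      · simp [hg]
      · rw [hf]; simp
    · obtain ⟨Y', e', hY', he'⟩ := exists_iso_of_ne_zero hT hY _ hg
      obtain ⟨A, B, D, e₁, e₂, hB, hD, hf⟩ := ih hY' (biprod.inr ≫ e.inv ≫ f ≫ e'.hom ≫ biprod.snd)
      -- Clear the row of the pivot: the shear `s` of `T ⊞ X'` removes the component `u` of `f`.
      let u : X' ⟶ T := biprod.inr ≫ e.inv ≫ f ≫ e'.hom ≫ biprod.fst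
      let s : T ⊞ X' ≅ T ⊞ X' :=
        { hom := biprod.lift (biprod.fst + biprod.snd ≫ u) biprod.snd
          inv := biprod.lift (biprod.fst - biprod.snd ≫ u) biprod.snd
          hom_inv_id := by ext <;> simp
          inv_hom_id := by ext <;> simp }
      refine ⟨T ⊞ A, B, D, e ≪≫ s ≪≫ biprod.mapIso (Iso.refl _) e₁ ≪≫
        (biprod.associator _ _ _).symm, e' ≪≫ biprod.mapIso (Iso.refl _) e₂ ≪≫
        (biprod.associator _ _ _).symm, hB, hD, ?_⟩
      rw [← cancel_epi e.inv, ← cancel_mono (e' ≪≫ biprod.mapIso (Iso.refl _) e₂).hom]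
      have he'' : biprod.inl ≫ e.inv ≫ f ≫ e'.hom = biprod.inl := by simpa using he'
      have he₂ : biprod.inl ≫ e.inv ≫ f ≫ e'.hom ≫ biprod.snd = 0 := by
        rw [reassoc_of% he'', biprod.inl_snd]
      ext
      · simp [reassoc_of% he'', s]
      · simp [reassoc_of% he'', s]
      · simp [reassoc_of% he₂, s]
      · simp [s, u]
      · simp [s, reassoc_of% hf]
      · simp [s, reassoc_of% hf]

lemma kernel {X Y : C} (hX : IsFinitePower T X) (hY : IsFinitePower T Y) (f : X ⟶ Y) :
    IsFinitePower T (kernel f) := by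
  obtain ⟨A, B, D, e, e', hB, hD, rfl⟩ := exists_normal_form hT hX hY f
  have h : IsLimit (KernelFork.ofι (f := e.hom ≫ biprod.fst ≫ biprod.inl ≫ e'.inv)
      (biprod.inr ≫ e.inv) (by simp)) :=
    KernelFork.IsLimit.ofι' _ _ fun {W} k hk => ⟨k ≫ e.hom ≫ biprod.snd, by
      have h0 : k ≫ e.hom ≫ biprod.fst = 0 := by
        rw [← cancel_mono (biprod.inl ≫ e'.inv)]; simpa using hk
      rw [← cancel_mono e.hom]
      ext <;> simp [h0]⟩
  exact hB.of_iso ((kernelIsKernel _).conePointUniqueUpToIso h)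

lemma cokernel {X Y : C} (hX : IsFinitePower T X) (hY : IsFinitePower T Y) (f : X ⟶ Y) :
    IsFinitePower T (cokernel f) := by
  obtain ⟨A, B, D, e, e', hB, hD, rfl⟩ := exists_normal_form hT hX hY f
  have h : IsColimit (CokernelCofork.ofπ (f := e.hom ≫ biprod.fst ≫ biprod.inl ≫ e'.inv)
      (e'.hom ≫ biprod.snd) (by simp)) :=
    CokernelCofork.IsColimit.ofπ' _ _ fun {W} k hk => ⟨biprod.inr ≫ e'.inv ≫ k, by
      have h0 : biprod.inl ≫ e'.inv ≫ k = 0 := by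
        rw [← cancel_epi (e.hom ≫ biprod.fst)]; simpa using hk
      rw [← cancel_epi e'.inv]
      ext <;> simp [h0]⟩
  exact hD.of_iso ((cokernelIsCokernel _).coconePointUniqueUpToIso h)

/-- Finite powers of `T` are stable under homology, which is a cokernel of a map to a kernel. -/
lemma homology (S : ShortComplex C) (h₁ : IsFinitePower T S.X₁) (h₂ : IsFinitePower T S.X₂)
    (h₃ : IsFinitePower T S.X₃) : IsFinitePower T S.homology :=
  (cokernel hT h₁ ((kernel hT h₂ h₃ S.g).of_iso S.cyclesIsoKernel) S.toCycles).of_iso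
    (S.homologyIsCokernel.coconePointUniqueUpToIso (colimit.isColimit _))

end IsFinitePower

lemma IsFinitePower.hom_eq_zero {T T' X Y : C} (h : ∀ f : T ⟶ T', f = 0)
    (hX : IsFinitePower T X) (hY : IsFinitePower T' Y) (f : X ⟶ Y) : f = 0 := by
  induction hX generalizing Y with
  | zero h => exact h.eq_of_src _ _
  | @succ X X' e hX' ih =>
    have key : ∀ {Y : C}, IsFinitePower T' Y → ∀ g : T ⟶ Y, g = 0 := by
      intro Y hY
      induction hY with
      | zero h => exact fun g => h.eq_of_tgt _ _
      | succ e _ ih =>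
        intro g
        rw [← cancel_mono e.hom]
        ext
        · simp [h (g ≫ e.hom ≫ biprod.fst)]
        · simp [ih (g ≫ e.hom ≫ biprod.snd)]
    rw [← cancel_epi e.inv]
    ext
    · simp [key hY (biprod.inl ≫ e.inv ≫ f)]
    · simp [ih hY (biprod.inr ≫ e.inv ≫ f)]

end FinitePower

end Twistor

/-! ### Degeneration of a spectral sequence by weights -/

namespace Twistor

lemma two_le_of_three_le {r : ℤ} (hr : 3 ≤ r) : 2 ≤ r := by lia

section Degeneration

variable {C : Type*} [Category* C] [Abelian C]
  (E : SpectralSequence C (fun r ↦ ComplexShape.up' ((r - 1, 2 - r) : ℤ × ℤ)) 2)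
  (P : ℤ → C → Prop) (hiso : ∀ (w : ℤ) (X Y : C), (X ≅ Y) → P w X → P w Y)
  (hhom : ∀ (w : ℤ) (S : ShortComplex C), P w S.X₁ → P w S.X₂ → P w S.X₃ → P w S.homology)
  (hzero : ∀ (w w' : ℤ) (X Y : C), w' < w → P w X → P w' Y → ∀ f : X ⟶ Y, f = 0)
  (hE : ∀ pq : ℤ × ℤ, P pq.2 ((E.page 2).X pq))

include hzero in
/-- For `r ≥ 3` the differential `d_r` lowers the weight `q` by `r - 2 > 0`, and therefore vanishes. -/
lemma page_d_eq_zero_of_weight (r : ℤ) (hr : 3 ≤ r)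
    (h : ∀ pq : ℤ × ℤ, P pq.2 ((E.page r (two_le_of_three_le hr)).X pq)) (pq pq' : ℤ × ℤ) :
    (E.page r (two_le_of_three_le hr)).d pq pq' = 0 := by
  by_cases hpq : (ComplexShape.up' ((r - 1, 2 - r) : ℤ × ℤ)).Rel pq pq'
  · exact hzero pq.2 pq'.2 _ _ (by rw [← hpq, Prod.snd_add]; dsimp only; lia) (h pq) (h pq') _
  · exact (E.page r (two_le_of_three_le hr)).shape _ _ hpq

include hiso hhom hE in
/-- The differential `d₂` preserves the weight `q`, so that the page `E₃` has the same weights. -/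
lemma page_three_weight (pq : ℤ × ℤ) : P pq.2 ((E.page 3).X pq) := by
  refine hiso _ _ _ ((((E.page 2).homologyIsoSc' (pq - (1, 0)) pq (pq + (1, 0)) ?_ ?_).symm ≪≫
    E.iso 2 3 pq)) ?_
  · exact ComplexShape.prev_eq' _ (by simp)
  · exact ComplexShape.next_eq' _ (by simp)
  · have h₁ := hE (pq - (1, 0))
    have h₃ := hE (pq + (1, 0))
    rw [Prod.snd_sub, sub_zero] at h₁
    rw [Prod.snd_add, add_zero] at h₃
    exact hhom _ _ h₁ (hE pq) h₃

include hiso hhom hzero hE in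
/-- If the entries of the page `E₂` have weight `q` in the row `q`, the weights decrease along
`d_r` for `r ≥ 3`, so that these differentials vanish and the weights persist. -/
lemma page_weight (r : ℤ) (hr : 3 ≤ r) (pq : ℤ × ℤ) : P pq.2 ((E.page r (two_le_of_three_le hr)).X pq) := by
  induction r, hr using Int.leInduction generalizing pq with
  | base => exact page_three_weight E P hiso hhom hE pq
  | succ r hr ih =>
    have hd := page_d_eq_zero_of_weight E P hzero r hr ih
    refine hiso _ _ _ (?_ ≪≫ E.iso r (r + 1) pq) (ih pq)
    exact (ShortComplex.HomologyData.ofZeros ((E.page r (two_le_of_three_le hr)).sc pq) (hd _ _)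
      (hd _ _)).left.homologyIso.symm

end Degeneration

/-! ### The abutment of the spectral sequence of a filtered complex -/

section Abutment

variable {C : Type*} [Category* C] [Abelian C]

/-- Let `α` and `β` be morphisms to `H`, and let `π : H ⟶ Q` have kernel `im α`. If
`im α ≤ im β`, then the image of `β ≫ π` is `im β / im α`. -/
lemma nonempty_iso_cokernel_ofLE {A B H Q E : C} (α : A ⟶ H) (β : B ⟶ H) (π : H ⟶ Q)
    (w : α ≫ π = 0) (hex : (ShortComplex.mk α π w).Exact)
    (hle : imageSubobject α ≤ imageSubobject β)
    (u : B ⟶ E) (v : E ⟶ Q) [Epi u] [Mono v] (huv : u ≫ v = β ≫ π) :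
    Nonempty (cokernel (Subobject.ofLE _ _ hle) ≅ E) := by
  have sq : CommSq u (factorThruImageSubobject β) v ((imageSubobject β).arrow ≫ π) :=
    ⟨by simp [huv]⟩
  have : StrongEpi (factorThruImageSubobject β) := strongEpi_of_epi _
  have : HasLiftingProperty (factorThruImageSubobject β) v := StrongEpi.llp v
  let k : (imageSubobject β : C) ⟶ E := sq.lift
  have hk₁ : factorThruImageSubobject β ≫ k = u := sq.fac_left
  have hk₂ : k ≫ v = (imageSubobject β).arrow ≫ π := sq.fac_right
  have : Epi k := epi_of_epi_fac hk₁
  have w' : Subobject.ofLE _ _ hle ≫ k = 0 := by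
    rw [← cancel_mono v, ← cancel_epi (factorThruImageSubobject α), Category.assoc, hk₂]
    simp [w]
  have hex' : (ShortComplex.mk _ _ w').Exact := by
    rw [ShortComplex.exact_iff_exact_up_to_refinements]
    intro T x hx
    dsimp at x hx
    have h : (x ≫ (imageSubobject β).arrow) ≫ π = 0 := by
      rw [Category.assoc, ← hk₂, reassoc_of% hx, zero_comp]
    obtain ⟨T', e, he, y, hy⟩ := hex.exact_up_to_refinements _ h
    refine ⟨T', e, he, y ≫ factorThruImageSubobject α, ?_⟩
    dsimp at hy ⊢
    rw [← cancel_mono (imageSubobject β).arrow]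
    simpa using hy
  exact ⟨(cokernelIsCokernel _).coconePointUniqueUpToIso hex'.gIsCokernel⟩

variable {M : CochainComplex C ℤ} (W : ℤ →o Subobject M)

lemma subobject_shortExact (S : Subobject M) :
    (ShortComplex.mk S.arrow (cokernel.π S.arrow) (cokernel.condition _)).ShortExact where
  exact := ShortComplex.exact_cokernel _

lemma isZero_X_of_le {a b : ℤ} (h : a ≤ b) {i : ℤ}
    (hb : IsZero ((W b : CochainComplex C ℤ).X i)) :
    IsZero ((W a : CochainComplex C ℤ).X i) :=
  IsZero.of_mono ((Subobject.ofLE _ _ (W.monotone h)).f i) hb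

lemma isIso_arrow_of_le {a b : ℤ} (h : a ≤ b) {i : ℤ} (ha : IsIso ((W a).arrow.f i)) :
    IsIso ((W b).arrow.f i) := by
  have : Epi ((W b).arrow.f i) := by
    have e : (Subobject.ofLE _ _ (W.monotone h)).f i ≫ (W b).arrow.f i = (W a).arrow.f i := by
      rw [← HomologicalComplex.comp_f, Subobject.ofLE_arrow]
    exact epi_of_epi_fac e
  exact isIso_of_mono_of_epi _

/-- The projection `W_b ⟶ W_b / W_a`. -/
noncomputable def subquotπ {a b : ℤ} (h : a ≤ b) : (W b : CochainComplex C ℤ) ⟶ subquot W h :=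
  cokernel.π _

/-- `Hⁿ(W_b) ⟶ Hⁿ(W_b / W_a)` is an epimorphism if `Hⁿ⁺¹(W_a)` vanishes. -/
lemma epi_homologyMap_subquotπ {a b : ℤ} (h : a ≤ b) (n : ℤ)
    (ha : IsZero ((W a : CochainComplex C ℤ).X (n + 1))) :
    Epi (HomologicalComplex.homologyMap (subquotπ W h) n) := by
  have hS : (ShortComplex.mk (Subobject.ofLE (W a) (W b) (W.monotone h)) (cokernel.π _)
      (cokernel.condition _)).ShortExact :=
    { exact := ShortComplex.exact_cokernel _ }
  refine (hS.homology_exact₃ n (n + 1) rfl).epi_f (IsZero.eq_of_tgt ?_ _ _)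
  exact ShortComplex.isZero_homology_of_isZero_X₂ _ ha

/-- The map `W_b / W_a ⟶ M / W_a`. -/
noncomputable def subquotToCokernel {a b : ℤ} (h : a ≤ b) : subquot W h ⟶ cokernel (W a).arrow :=
  cokernel.map _ _ (𝟙 _) (W b).arrow (by simp)

lemma subquotπ_subquotMap_subquotToCokernel {a b a' b' : ℤ} (h : a ≤ b) (h' : a' ≤ b')
    (ha : a ≤ a') (hb : b ≤ b') :
    subquotπ W h ≫ subquotMap W h h' ha hb ≫ subquotToCokernel W h' =
      (W b).arrow ≫ cokernel.π (W a').arrow := by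
  unfold subquotπ subquotMap subquotToCokernel subquot
  simp

lemma isZero_cokernel_arrow_X {b i : ℤ} (hb : IsIso ((W b).arrow.f i)) :
    IsZero ((cokernel (W b).arrow).X i) := by
  have h0 : (W b).arrow.f i ≫ (cokernel.π (W b).arrow).f i = 0 := by
    rw [← HomologicalComplex.comp_f, cokernel.condition, HomologicalComplex.zero_f]
  have : Epi ((cokernel.π (W b).arrow).f i) :=
    (HomologicalComplex.eval C _ i).map_epi (cokernel.π (W b).arrow)
  exact IsZero.of_epi_eq_zero ((cokernel.π (W b).arrow).f i)
    ((cancel_epi ((W b).arrow.f i)).1 (h0.trans comp_zero.symm))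

/-- `Hⁿ(W_b / W_a) ⟶ Hⁿ(M / W_a)` is a monomorphism if `Hⁿ⁻¹(M / W_b)` vanishes. -/
lemma mono_homologyMap_subquotToCokernel {a b : ℤ} (h : a ≤ b) (n : ℤ)
    (hb : IsIso ((W b).arrow.f (n - 1))) :
    Mono (HomologicalComplex.homologyMap (subquotToCokernel W h) n) := by
  have w : subquotToCokernel W h ≫
      cokernel.map (W a).arrow (W b).arrow (Subobject.ofLE _ _ (W.monotone h)) (𝟙 _) (by simp) =
        0 := by
    unfold subquotToCokernel subquot
    rw [← cancel_epi (cokernel.π _)]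
    simp
  have hS := shortExact_cokernel_of_comp (Subobject.ofLE _ _ (W.monotone h)) (W b).arrow
    (W a).arrow (𝟙 _) (𝟙 _) rfl rfl (by simp) (by simp) (by simp) w
  refine (hS.homology_exact₁ (n - 1) n (by simp)).mono_g (IsZero.eq_of_src ?_ _ _)
  exact ShortComplex.isZero_homology_of_isZero_X₂ _ (isZero_cokernel_arrow_X W hb)

/-- The entry `Eⁿ(f₁, f₂, f₃)` of a spectral object is the image of a map
`Hⁿ(f₁ ≫ f₂) ⟶ Hⁿ(f₂ ≫ f₃)`. -/
lemma exists_epi_mono_factorization_E {ι : Type*} [Category* ι] (X : Abelian.SpectralObject C ι)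
    {i₀ i₁ i₂ i₃ : ι} (f₁ : i₀ ⟶ i₁) (f₂ : i₁ ⟶ i₂) (f₃ : i₂ ⟶ i₃) (f₁₂ : i₀ ⟶ i₂) (f₂₃ : i₁ ⟶ i₃)
    (h₁₂ : f₁ ≫ f₂ = f₁₂) (h₂₃ : f₂ ≫ f₃ = f₂₃) (n₀ n₁ n₂ : ℤ)
    (hn₁ : n₀ + 1 = n₁) (hn₂ : n₁ + 1 = n₂) {Z : C} (e : Z ≅ X.E f₁ f₂ f₃ n₀ n₁ n₂ hn₁ hn₂) :
    ∃ (p : (X.H n₁).obj (ComposableArrows.mk₁ f₁₂) ⟶ Z)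
      (i : Z ⟶ (X.H n₁).obj (ComposableArrows.mk₁ f₂₃)),
      Epi p ∧ Mono i ∧ p ≫ i =
        (X.H n₁).map (ComposableArrows.twoδ₁Toδ₀ f₁ f₂ f₁₂ h₁₂) ≫
          (X.H n₁).map (ComposableArrows.twoδ₂Toδ₁ f₂ f₃ f₂₃ h₂₃) := by
  refine ⟨(X.toCycles f₁ f₂ f₁₂ h₁₂ n₁ ≫ X.πE f₁ f₂ f₃ n₀ n₁ n₂ hn₁ hn₂) ≫ e.inv,
    e.hom ≫ X.ιE f₁ f₂ f₃ n₀ n₁ n₂ hn₁ hn₂ ≫ X.fromOpcycles f₂ f₃ f₂₃ h₂₃ n₁,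
    epi_comp _ _, mono_comp _ _, ?_⟩
  rw [Category.assoc, e.inv_hom_id_assoc, Category.assoc,
    X.πE_ιE_assoc f₁ f₂ f₃ n₀ n₁ n₂ hn₁ hn₂, X.toCycles_i_assoc, X.p_fromOpcycles]

/-- The entry `E_r^{-m,n+m}` is the image of `Hⁿ(W_m / W_{m-r+1}) ⟶ Hⁿ(W_{m+r-2} / W_{m-1})`. -/
lemma exists_epi_mono_factorization_page {r m n : ℤ} (hr : 3 ≤ r) (h₁₂ : m - r + 1 ≤ m)
    (h₂₃ : m - 1 ≤ m + r - 2) (h : m - r + 1 ≤ m - 1) (h' : m ≤ m + r - 2) :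
    ∃ (p : (subquot W h₁₂).homology n ⟶
        ((filteredSpectralSequence W).page r (two_le_of_three_le hr)).X (-m, n + m))
      (i : ((filteredSpectralSequence W).page r (two_le_of_three_le hr)).X (-m, n + m) ⟶
        (subquot W h₂₃).homology n), Epi p ∧ Mono i ∧
      p ≫ i = HomologicalComplex.homologyMap (subquotMap W h₁₂ h₂₃ h h') n := by
  let X := filteredSpectralObject W
  let e := X.spectralSequencePageXIso weightCore r (by lia) (-m, n + m) (m - r + 1) (m - 1) m
    (m + r - 2) (by simp [weightCore]) (by simp [weightCore]) (by simp [weightCore])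
    (by simp [weightCore]) (n - 1) n (n + 1) (by simp [weightCore])
  obtain ⟨p, i, hp, hi, hpi⟩ := exists_epi_mono_factorization_E X (homOfLE h)
    (homOfLE (show m - 1 ≤ m by lia)) (homOfLE h') (homOfLE h₁₂) (homOfLE h₂₃) rfl rfl (n - 1) n
    (n + 1) (by lia) rfl e
  refine ⟨p, i, hp, hi, hpi.trans ?_⟩
  have h₁₂' : m - 1 ≤ m := by lia
  refine (HomologicalComplex.homologyMap_comp (subquotMap W h₁₂ h₁₂' h le_rfl)
    (subquotMap W h₁₂' h₂₃ le_rfl h') n).symm.trans ?_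
  rw [subquotMap_comp]

/-- The graded pieces of the filtration induced on the cohomology of a complex with a degreewise
finite filtration are entries of the pages `E_r`, for `r` large. -/
lemma exists_gr_inducedFiltration_iso_page (hW : IsDegreewiseFinite W) (n m : ℤ) :
    ∃ (r : ℤ) (hr : 3 ≤ r), Nonempty (gr (inducedFiltration W n) m ≅
      ((filteredSpectralSequence W).page r (two_le_of_three_le hr)).X (-m, n + m)) := by
  obtain ⟨a, ha⟩ := (hW (n + 1)).1
  obtain ⟨b, hb⟩ := (hW (n - 1)).2
  -- `W_{m-r+1}` has to vanish in degree `n + 1`, and `W_{m+r-2}` has to be everything in degree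
  -- `n - 1`.
  obtain ⟨r, hr₃, hra, hrb⟩ : ∃ r : ℤ, 3 ≤ r ∧ m - r + 1 ≤ a ∧ b ≤ m + r - 2 :=
    ⟨max 3 (max (m + 1 - a) (b + 2 - m)), by lia, by lia, by lia⟩
  refine ⟨r, hr₃, ?_⟩
  have h₁₂ : m - r + 1 ≤ m := by lia
  have h₂₃ : m - 1 ≤ m + r - 2 := by lia
  obtain ⟨p, i, hp, hi, hpi⟩ := exists_epi_mono_factorization_page W (n := n) hr₃ h₁₂ h₂₃
    (by lia) (by lia)
  have hu := epi_homologyMap_subquotπ W h₁₂ n (isZero_X_of_le W hra ha)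
  have hv := mono_homologyMap_subquotToCokernel W h₂₃ n (isIso_arrow_of_le W hrb hb)
  have hu' := epi_comp' hu hp
  have hv' := mono_comp' hi hv
  exact nonempty_iso_cokernel_ofLE _ _ _ _
    ((subobject_shortExact (W (m - 1))).homology_exact₂ n)
    ((inducedFiltration W n).monotone (by lia)) _ _ (by
      rw [Category.assoc, reassoc_of% hpi, ← HomologicalComplex.homologyMap_comp,
        ← HomologicalComplex.homologyMap_comp, subquotπ_subquotMap_subquotToCokernel,
        HomologicalComplex.homologyMap_comp])

end Abutment

end Twistor

namespace Twistor

/-! ### Finite filtrations and classes closed under extensions -/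

section FilteredExtension

variable {C : Type*} [Category* C] [Abelian C] {X : C} (F : ℤ →o Subobject X)
  (P : C → Prop) (hzero : ∀ Y : C, IsZero Y → P Y)
  (hext : ∀ S : ShortComplex C, S.ShortExact → P S.X₁ → P S.X₃ → P S.X₂)

include hzero hext

/-- If a class of objects is closed under extensions and contains the graded pieces of a filtration
which starts with zero, then it contains all the terms of the filtration. -/
lemma subobject_mem_of_gr {a : ℤ} (ha : IsZero (F a : C)) (hgr : ∀ n, P (gr F n)) (n : ℤ) :
    P (F n : C) := by
  obtain h | h := le_total n a
  · exact hzero _ (IsZero.of_mono (Subobject.ofLE _ _ (F.monotone h)) ha)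
  · induction n, h using Int.leInduction with
    | base => exact hzero _ ha
    | succ n _ ih =>
      -- Stated for variable indices, since `n + 1 - 1` and `n` are not definitionally equal.
      have hg : ∀ k m (hk : k ≤ m), k = m - 1 →
          P (cokernel (Subobject.ofLE (F k) (F m) (F.monotone hk))) := by
        rintro _ m _ rfl
        exact hgr m
      exact hext (ShortComplex.mk (Subobject.ofLE (F n) (F (n + 1)) (F.monotone (by lia)))
        (cokernel.π _) (cokernel.condition _)) { exact := ShortComplex.exact_cokernel _ } ih
        (hg n (n + 1) (by lia) (by lia))

/-- If a class of objects is closed under extensions and contains the graded pieces of a filtration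
of `X` which reaches `X`, then it contains the quotients of `X` by the terms of the filtration. -/
lemma cokernel_arrow_mem_of_gr {b : ℤ} (hb : F b = ⊤) (hgr : ∀ n, P (gr F n)) (n : ℤ) :
    P (cokernel (F n).arrow) := by
  have htop : ∀ m, b ≤ m → P (cokernel (F m).arrow) := fun m hm => by
    have hm : F m = ⊤ := top_le_iff.1 (hb.symm.le.trans (F.monotone hm))
    have := (Subobject.isIso_arrow_iff_eq_top _).2 hm
    exact hzero _ (isZero_cokernel_of_epi _)
  obtain h | h := le_total b n
  · exact htop n h
  · induction n, h using Int.leInductionDown with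
    | base => exact htop b le_rfl
    | pred n _ ih =>
      have w : cokernel.map (Subobject.ofLE _ _ (F.monotone (show n - 1 ≤ n by lia)))
          (F (n - 1)).arrow (𝟙 _) (F n).arrow (by simp) ≫
            cokernel.map (F (n - 1)).arrow (F n).arrow (Subobject.ofLE _ _ (F.monotone (by lia)))
              (𝟙 _) (by simp) = 0 := by
        rw [← cancel_epi (cokernel.π _)]
        simp
      exact hext _ (shortExact_cokernel_of_comp (Subobject.ofLE _ _ (F.monotone (by lia)))
        (F n).arrow (F (n - 1)).arrow (𝟙 _) (𝟙 _) rfl rfl (by simp) (by simp) (by simp) w)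
        (hgr n) ih

end FilteredExtension

section InducedFiltration

variable {C : Type*} [Category* C] [Abelian C] {M : CochainComplex C ℤ} (W : ℤ →o Subobject M)

lemma exists_isZero_inducedFiltration (hW : IsDegreewiseFinite W) (i : ℤ) :
    ∃ a, IsZero (inducedFiltration W i a : C) := by
  obtain ⟨a, ha⟩ := (hW i).1
  refine ⟨a, ?_⟩
  have h : IsZero ((W a : CochainComplex C ℤ).homology i) :=
    ShortComplex.isZero_homology_of_isZero_X₂ _ ha
  have : inducedFiltration W i a = ⊥ := by
    change imageSubobject (HomologicalComplex.homologyMap (W a).arrow i) = ⊥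
    rw [h.eq_of_src (HomologicalComplex.homologyMap (W a).arrow i) 0, imageSubobject_zero]
  rw [this]
  exact (isZero_zero C).of_iso Subobject.botCoeIsoZero

lemma exists_inducedFiltration_eq_top (hW : IsDegreewiseFinite W) (i : ℤ) :
    ∃ b, inducedFiltration W i b = ⊤ := by
  obtain ⟨b, hb⟩ := (hW i).2
  refine ⟨b, ?_⟩
  have : Epi (HomologicalComplex.homologyMap (W b).arrow i) :=
    ((subobject_shortExact (W b)).homology_exact₂ i).epi_f
      ((ShortComplex.isZero_homology_of_isZero_X₂ _ (isZero_cokernel_arrow_X W hb)).eq_of_tgt _ _)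
  have : Epi (imageSubobject (HomologicalComplex.homologyMap (W b).arrow i)).arrow :=
    epi_of_epi_fac (imageSubobject_arrow_comp (HomologicalComplex.homologyMap (W b).arrow i))
  have : IsIso (imageSubobject (HomologicalComplex.homologyMap (W b).arrow i)).arrow :=
    isIso_of_mono_of_epi _
  exact (Subobject.isIso_arrow_iff_eq_top _).1 this

end InducedFiltration

end Twistor

namespace Twistor

/-! ### Free sheaves of modules of finite rank -/

section Free

universe u v₁ u₁

variable {C : Type u₁} [Category.{v₁} C] {J : GrothendieckTopology C} {R : Sheaf J RingCat.{u}}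

lemma val_app_sum {M N : SheafOfModules.{u} R} {I : Type*} (t : Finset I) (f : I → (M ⟶ N))
    (X : Cᵒᵖ) (m : M.val.obj X) :
    (∑ i ∈ t, f i).val.app X m = ∑ i ∈ t, (f i).val.app X m := by
  classical
  induction t using Finset.induction_on with
  | empty => simp; rfl
  | insert a t ha ih => rw [Finset.sum_insert ha, Finset.sum_insert ha, ← ih]; rfl

lemma isIso_of_bijective_app {M N : SheafOfModules.{u} R} (f : M ⟶ N)
    (h : ∀ X, Function.Bijective (f.val.app X)) : IsIso f := by
  have h' : ∀ X, IsIso (f.val.app X) := fun X =>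
    (ConcreteCategory.isIso_iff_bijective (f.val.app X)).2 (h X)
  have : IsIso ((PresheafOfModules.toPresheaf _).map f.val) := by
    refine (NatTrans.isIso_iff_isIso_app _).2 fun X => ?_
    exact inferInstanceAs (IsIso ((forget₂ _ AddCommGrpCat).map (f.val.app X)))
  have : IsIso ((SheafOfModules.forget R).map f) :=
    isIso_of_reflects_iso f.val (PresheafOfModules.toPresheaf _)
  exact isIso_of_reflects_iso f (SheafOfModules.forget R)

lemma bijective_app_of_isIso {M N : SheafOfModules.{u} R} (f : M ⟶ N) [IsIso f] (X : Cᵒᵖ) :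
    Function.Bijective (f.val.app X) := by
  have : IsIso (f.val.app X) := inferInstanceAs (IsIso ((SheafOfModules.evaluation R X).map f))
  exact (ConcreteCategory.isIso_iff_bijective (f.val.app X)).1 this

variable [HasWeakSheafify J AddCommGrpCat.{u}] [J.WEqualsLocallyBijective AddCommGrpCat.{u}]

lemma free_hom_ext {I : Type u} {M : SheafOfModules.{u} R} {f g : SheafOfModules.free I ⟶ M}
    (h : ∀ i, SheafOfModules.ιFree i ≫ f = SheafOfModules.ιFree i ≫ g) : f = g :=
  Cofan.IsColimit.hom_ext (SheafOfModules.isColimitFreeCofan I) _ _ h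

/-- The projection of a free sheaf of modules onto a coordinate. -/
noncomputable def freeProj {I : Type u} [DecidableEq I] (j : I) :
    SheafOfModules.free (R := R) I ⟶ SheafOfModules.unit R :=
  Cofan.IsColimit.desc (SheafOfModules.isColimitFreeCofan I) fun i => if i = j then 𝟙 _ else 0

lemma ιFree_freeProj {I : Type u} [DecidableEq I] (i j : I) :
    SheafOfModules.ιFree (R := R) i ≫ freeProj j = if i = j then 𝟙 _ else 0 :=
  Cofan.IsColimit.fac (SheafOfModules.isColimitFreeCofan I) _ i

lemma sum_freeProj_ιFree {I : Type u} [DecidableEq I] [Fintype I] :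
    ∑ j : I, freeProj j ≫ SheafOfModules.ιFree (R := R) j = 𝟙 _ := by
  refine free_hom_ext fun i => ?_
  simp only [Preadditive.comp_sum, ← Category.assoc, ιFree_freeProj]
  rw [Finset.sum_eq_single i]
  · simp
  · intro j _ hj
    simp [hj.symm]
  · simp

/-- A finite family of sections is a basis over every object if and only if the
morphism from the free sheaf which it defines is an isomorphism. -/
lemma isIso_freeHomEquiv_symm_iff {M : SheafOfModules.{u} R} {I : Type u} [Fintype I]
    (s : I → M.sections) :
    IsIso (M.freeHomEquiv.symm s) ↔
      ∀ X : Cᵒᵖ, Function.Bijective fun c : I → R.obj.obj X =>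
        ∑ i, (c i • ((s i).eval X : M.val.obj X) : M.val.obj X) := by
  classical
  -- The sections of the free sheaf are the families of coordinates, as the free sheaf is a finite
  -- biproduct.
  let e : ∀ X : Cᵒᵖ, (I → R.obj.obj X) → (SheafOfModules.free (R := R) I).val.obj X :=
    fun X c => ∑ i, (SheafOfModules.ιFree (R := R) i).val.app X (c i)
  have hπ : ∀ X : Cᵒᵖ, (fun c : I → R.obj.obj X =>
        ∑ i, (c i • ((s i).eval X : M.val.obj X) : M.val.obj X)) =
      (M.freeHomEquiv.symm s).val.app X ∘ e X := by
    intro X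
    funext c
    simp only [Function.comp, e, map_sum]
    refine Finset.sum_congr rfl fun i _ => ?_
    have h1 : s i = SheafOfModules.sectionsMap (M.freeHomEquiv.symm s)
        (SheafOfModules.freeSection i) :=
      (SheafOfModules.sectionsMap_freeHomEquiv_symm_freeSection s i).symm
    have h2 : (s i).eval X = ((SheafOfModules.ιFree i ≫ M.freeHomEquiv.symm s).val.app X
      (1 : R.obj.obj X)) := by rw [h1]; rfl
    change _ = (SheafOfModules.ιFree i ≫ M.freeHomEquiv.symm s).val.app X (c i)
    rw [h2]
    refine (LinearMap.map_smul ((SheafOfModules.ιFree i ≫ M.freeHomEquiv.symm s).val.app X).hom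
      (c i) (1 : R.obj.obj X)).symm.trans ?_
    congr 1
    exact mul_one (c i)
  have he : ∀ X : Cᵒᵖ, Function.Bijective (e X) := by
    intro X
    refine Function.bijective_iff_has_inverse.2 ⟨fun m j => (freeProj j).val.app X m, ?_, ?_⟩
    · intro c
      funext j
      simp only [e, map_sum]
      rw [Finset.sum_eq_single j]
      · change ((SheafOfModules.ιFree j ≫ freeProj j).val.app X (c j) : R.obj.obj X) = _
        rw [ιFree_freeProj, if_pos rfl]
        rfl
      · intro i _ hij
        change ((SheafOfModules.ιFree i ≫ freeProj j).val.app X (c i) : R.obj.obj X) = _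
        rw [ιFree_freeProj, if_neg hij]
        rfl
      · simp
    · intro m
      have h := val_app_sum Finset.univ
        (fun j => freeProj (R := R) j ≫ SheafOfModules.ιFree j) X m
      rw [sum_freeProj_ιFree] at h
      exact h.symm
  refine ⟨fun h X => ?_, fun h => isIso_of_bijective_app _ fun X => ?_⟩
  · rw [hπ]
    exact (bijective_app_of_isIso _ X).comp (he X)
  · have := h X
    rw [hπ] at this
    exact (he X).of_comp_iff _ |>.1 this

end Free

end Twistor

namespace Twistor

/-! ### Local frames of vector bundles -/

section Frames

/-- The sections of a sheaf of `𝒪`-modules over an open subset. -/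
abbrev Sec (E : Mods) (U : Opens (TopCat.of ProjLine)) : Type := E.val.obj (op U)

/-- The restriction of sections of a sheaf of `𝒪`-modules. -/
noncomputable def res (E : Mods) {U V : Opens (TopCat.of ProjLine)} (h : V ≤ U) : Sec E U →+ Sec E V :=
  (E.val.presheaf.map (homOfLE h).op).hom

variable {E E' : Mods} {U V W : Opens (TopCat.of ProjLine)}

@[simp]
lemma res_res (h : V ≤ U) (h' : W ≤ V) (s : Sec E U) :
    res E h' (res E h s) = res E (h'.trans h) s := by
  change (E.val.presheaf.map (homOfLE h).op ≫ E.val.presheaf.map (homOfLE h').op).hom s = _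
  rw [← E.val.presheaf.map_comp]
  rfl

/-- The map on sections over `U` given by a morphism of sheaves of `𝒪`-modules. -/
def app (f : E ⟶ E') (U : Opens (TopCat.of ProjLine)) :
    Sec E U →ₗ[structureSheaf.obj.obj (op U)] Sec E' U :=
  (f.val.app (op U)).hom

lemma app_res (f : E ⟶ E') (h : V ≤ U) (s : Sec E U) :
    app f V (res E h s) = res E' h (app f U s) :=
  PresheafOfModules.naturality_apply f.val (homOfLE h).op s

lemma app_comp {E'' : Mods} (f : E ⟶ E') (g : E' ⟶ E'') (s : Sec E U) :
    app (f ≫ g) U s = app g U (app f U s) := rfl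

lemma app_zero (s : Sec E U) : app (0 : E ⟶ E') U s = 0 := rfl

/-- A finite family of sections of `E` over `U` is a frame if it is a basis of the sections of `E`
over every open subset of `U`. -/
def IsFrame {ι : Type} [Fintype ι] (s : ι → Sec E U) : Prop :=
  ∀ (V : Opens (TopCat.of ProjLine)) (h : V ≤ U),
    Function.Bijective fun c : ι → structureSheaf.obj.obj (op V) =>
      (∑ i, (c i • res E h (s i) : Sec E V) : Sec E V)

/-- The sections of the restriction of `E` to `U` given by a section of `E` over `U`. -/
noncomputable def overSection (s : Sec E U) : (E.over U).sections :=
  PresheafOfModules.sectionsMk (fun X => res E X.unop.hom.le s)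
    (fun _ _ f => res_res _ f.unop.left.le s)

/-- A sheaf of `𝒪`-modules with local frames is a vector bundle. The cover is indexed by the points
of `ℙ¹`. -/
lemma isVectorBundle_of_frames
    (h : ∀ x : ProjLine, ∃ (U : Opens (TopCat.of ProjLine)) (_ : x ∈ U) (ι : Type)
      (_ : Fintype ι) (s : ι → Sec E U), IsFrame s) : IsVectorBundle E := by
  choose U hU ι inst s hs using h
  have hiso : ∀ x, IsIso ((E.over (U x)).freeHomEquiv.symm fun i => overSection (s x i)) := by
    intro x
    refine (isIso_freeHomEquiv_symm_iff _).2 fun X => ?_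
    exact hs x X.unop.left X.unop.hom.le
  let g : ∀ x, (E.over (U x)).GeneratingSections := fun x =>
    { I := ι x, s := fun i => overSection (s x i), epi := by have := hiso x; infer_instance }
  have hg : ∀ x, (g x).IsFiniteType := fun x => ⟨inferInstanceAs (Finite (ι x))⟩
  refine ⟨{ I := ProjLine, X := U, coversTop := ?_, generators := g }, ⟨hiso⟩, ⟨hg⟩⟩
  intro V x hx
  exact ⟨V ⊓ U x, homOfLE inf_le_left, ⟨x, ⟨homOfLE inf_le_right⟩⟩, hx, hU x⟩

/-- A vector bundle has local frames. -/
lemma IsVectorBundle.exists_frame (hE : IsVectorBundle E) (x : ProjLine) :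
    ∃ (U : Opens (TopCat.of ProjLine)) (_ : x ∈ U) (ι : Type) (_ : Fintype ι)
      (s : ι → Sec E U), IsFrame s := by
  obtain ⟨q, hq, hq'⟩ := hE
  obtain ⟨U, f, ⟨i, ⟨g⟩⟩, hU⟩ := q.coversTop ⊤ x trivial
  have hfin : Finite (q.generators i).I := (hq'.isFiniteType i).finite
  have := Fintype.ofFinite (q.generators i).I
  have hiso := hq.isIso i
  refine ⟨U, hU, (q.generators i).I, inferInstance,
    fun j => ((q.generators i).s j).eval (op (Over.mk g)), fun V hV => ?_⟩
  have h1 := (isIso_freeHomEquiv_symm_iff _).1 hiso (op (Over.mk (homOfLE hV ≫ g)))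
  have h2 : ∀ j, res E hV (((q.generators i).s j).eval (op (Over.mk g))) =
      ((q.generators i).s j).eval (op (Over.mk (homOfLE hV ≫ g))) := fun j =>
    PresheafOfModules.sections_property ((q.generators i).s j)
      (Over.homMk (U := Over.mk (homOfLE hV ≫ g)) (V := Over.mk g) (homOfLE hV)).op
  simp only [h2]
  exact h1

end Frames

end Twistor

namespace Twistor

/-! ### Extensions of vector bundles -/

section LocalSurj

universe u v₁ u₁

variable {C : Type u₁} [Category.{v₁} C] {J : GrothendieckTopology C} {R : Sheaf J RingCat.{u}}
  [HasSheafify J AddCommGrpCat.{u}] [J.WEqualsLocallyBijective AddCommGrpCat.{u}]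

/-- An epimorphism of sheaves of modules is locally surjective. The cokernel of the underlying
morphism of presheaves has zero sheafification, and the unit of the sheafification is locally
injective. -/
lemma exists_local_lift_of_epi {M N : SheafOfModules.{u} R} (p : M ⟶ N) [Epi p] (X : Cᵒᵖ)
    (n : N.val.obj X) :
    ∃ S ∈ J X.unop, ∀ ⦃Y : C⦄ (f : Y ⟶ X.unop), S f →
      ∃ m : M.val.obj (op Y), p.val.app (op Y) m = N.val.presheaf.map f.op n := by
  let Q := cokernel p.val
  let L := (PresheafOfModules.sheafification (𝟙 R.obj)).obj Q
  let u : Q ⟶ L.val := PresheafOfModules.sheafificationHomEquiv (𝟙 R.obj) (𝟙 L)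
  have hu : (PresheafOfModules.toPresheaf _).map u = toSheafify J Q.presheaf :=
    (PresheafOfModules.toPresheaf_map_sheafificationHomEquiv_def (𝟙 R.obj) (𝟙 L)).trans
      (by simp; rfl)
  let g : N ⟶ L := ⟨cokernel.π p.val ≫ u⟩
  have hg : g = 0 := by
    rw [← cancel_epi p, comp_zero]
    ext1
    change p.val ≫ cokernel.π p.val ≫ u = 0
    rw [cokernel.condition_assoc, zero_comp]
  have hinj : Presheaf.IsLocallyInjective J (toSheafify J Q.presheaf) := inferInstance
  let q : Q.obj X := (cokernel.π p.val).app X n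
  have hq : (toSheafify J Q.presheaf).app X q = (toSheafify J Q.presheaf).app X 0 := by
    rw [map_zero, ← hu]
    change g.val.app X n = 0
    rw [hg]
    rfl
  refine ⟨_, Presheaf.equalizerSieve_mem J (toSheafify J Q.presheaf) (X := X) q 0 hq,
    fun Y f hf => ?_⟩
  have hf' : (cokernel.π p.val).app (op Y) (N.val.presheaf.map f.op n) = 0 := by
    have h1 : Q.presheaf.map f.op q = Q.presheaf.map f.op 0 := hf
    rw [map_zero] at h1
    exact (PresheafOfModules.naturality_apply (cokernel.π p.val) f.op n).trans h1
  have hex : ((ShortComplex.mk p.val (cokernel.π p.val) (cokernel.condition _)).map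
      (PresheafOfModules.evaluation _ (op Y))).Exact :=
    (ShortComplex.exact_cokernel p.val).map_of_epi_of_preservesCokernel _ inferInstance
      inferInstance
  exact (ShortComplex.moduleCat_exact_iff _).1 hex _ hf'

end LocalSurj

section Extension

lemma exists_local_lift {E B : Mods} (p : E ⟶ B) [Epi p] {U : Opens (TopCat.of ProjLine)}
    (b : Sec B U) {x : ProjLine} (hx : x ∈ U) :
    ∃ (V : Opens (TopCat.of ProjLine)) (h : V ≤ U) (_ : x ∈ V) (e : Sec E V),
      app p V e = res B h b := by
  obtain ⟨S, hS, h⟩ := exists_local_lift_of_epi p (op U) b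
  obtain ⟨V, f, hf, hV⟩ := hS x hx
  obtain ⟨m, hm⟩ := h f hf
  exact ⟨V, f.le, hV, m, hm⟩

lemma injective_app {A E : Mods} (f : A ⟶ E) [Mono f] (U : Opens (TopCat.of ProjLine)) :
    Function.Injective (app f U) := by
  have : Mono ((SheafOfModules.evaluation structureSheaf (op U)).map f) := inferInstance
  exact (ModuleCat.mono_iff_injective _).1 this

/-- Taking sections is left exact. -/
lemma exists_app_eq {S : ShortComplex Mods} (hS : S.ShortExact) {U : Opens (TopCat.of ProjLine)}
    (e : Sec S.X₂ U) (he : app S.g U e = 0) : ∃ a, app S.f U a = e := by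
  have := hS.mono_f
  have : (SheafOfModules.evaluation structureSheaf (op U)).PreservesZeroMorphisms :=
    ⟨fun _ _ => rfl⟩
  have h := hS.exact.map_of_mono_of_preservesKernel
    (SheafOfModules.evaluation structureSheaf (op U)) inferInstance inferInstance
  exact (ShortComplex.moduleCat_exact_iff _).1 h e he

lemma exists_local_lifts {E B : Mods} (p : E ⟶ B) [Epi p] {U : Opens (TopCat.of ProjLine)}
    {ι : Type} [Fintype ι] (b : ι → Sec B U) {x : ProjLine} (hx : x ∈ U) :
    ∃ (V : Opens (TopCat.of ProjLine)) (h : V ≤ U) (_ : x ∈ V) (e : ι → Sec E V),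
      ∀ i, app p V (e i) = res B h (b i) := by
  choose V hV hxV e he using fun i => exists_local_lift p (b i) hx
  refine ⟨U ⊓ ⟨⋂ i, (V i : Set ProjLine), isOpen_iInter_of_finite fun i => (V i).2⟩, inf_le_left,
    ⟨hx, Set.mem_iInter.2 hxV⟩, fun i => res E (V := _) (U := V i) ?_ (e i), fun i => ?_⟩
  · exact inf_le_right.trans fun y hy => Set.mem_iInter.1 hy i
  · rw [app_res, he, res_res]

/-- Vector bundles are stable under extensions: the image of a local frame of the subsheaf and local
lifts of a frame of the quotient form a local frame. -/
lemma isVectorBundle_of_shortExact {S : ShortComplex Mods} (hS : S.ShortExact)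
    (h₁ : IsVectorBundle S.X₁) (h₃ : IsVectorBundle S.X₃) : IsVectorBundle S.X₂ := by
  refine isVectorBundle_of_frames fun x => ?_
  obtain ⟨U, hxU, ι, _, a, ha⟩ := h₁.exists_frame x
  obtain ⟨U', hxU', κ, _, b, hb⟩ := h₃.exists_frame x
  have := hS.epi_g
  obtain ⟨V, hVU', hxV, e, he⟩ := exists_local_lifts S.g b hxU'
  refine ⟨U ⊓ V, ⟨hxU, hxV⟩, ι ⊕ κ, inferInstance,
    Sum.elim (fun i => app S.f _ (res S.X₁ inf_le_left (a i)))
      (fun j => res S.X₂ inf_le_right (e j)), fun W hW => ?_⟩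
  have hsum : ∀ c : ι ⊕ κ → structureSheaf.obj.obj (op W),
      (∑ i, c i • res S.X₂ hW (Sum.elim (fun i => app S.f _ (res S.X₁ inf_le_left (a i)))
        (fun j => res S.X₂ inf_le_right (e j)) i) : Sec S.X₂ W) =
      app S.f W (∑ i, c (Sum.inl i) • res S.X₁ (hW.trans inf_le_left) (a i)) +
        ∑ j, c (Sum.inr j) • res S.X₂ (hW.trans inf_le_right) (e j) := by
    intro c
    rw [Fintype.sum_sum_type, map_sum]
    refine congr_arg₂ (· + ·) (Finset.sum_congr rfl fun i _ => ?_)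
      (Finset.sum_congr rfl fun j _ => ?_)
    · rw [Sum.elim_inl, ← app_res, res_res, map_smul]
    · rw [Sum.elim_inr, res_res]
  have hg : ∀ c : κ → structureSheaf.obj.obj (op W),
      app S.g W (∑ j, c j • res S.X₂ (hW.trans inf_le_right) (e j)) =
        ∑ j, c j • res S.X₃ ((hW.trans inf_le_right).trans hVU') (b j) := by
    intro c
    rw [map_sum]
    refine Finset.sum_congr rfl fun j _ => ?_
    rw [map_smul, app_res, he, res_res]
  have hfg : ∀ m, app S.g W (app S.f W m) = 0 := fun m => by
    rw [← app_comp, S.zero, app_zero]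
  have := hS.mono_f
  constructor
  · intro c c' hc
    dsimp only at hc
    rw [hsum, hsum] at hc
    have hr : (fun j => c (Sum.inr j)) = fun j => c' (Sum.inr j) := by
      refine (hb W ((hW.trans inf_le_right).trans hVU')).1 ?_
      have := congrArg (app S.g W) hc
      rwa [map_add, map_add, hfg, hfg, zero_add, zero_add, hg, hg] at this
    have hl : (fun i => c (Sum.inl i)) = fun i => c' (Sum.inl i) := by
      refine (ha W (hW.trans inf_le_left)).1 (injective_app S.f W ?_)
      simp only [fun j => congrFun hr j] at hc
      exact add_right_cancel hc
    funext i
    obtain i | j := i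
    · exact congrFun hl i
    · exact congrFun hr j
  · intro m
    obtain ⟨d, hd⟩ := (hb W ((hW.trans inf_le_right).trans hVU')).2 (app S.g W m)
    obtain ⟨m', hm'⟩ := exists_app_eq hS
      (m - ∑ j, d j • res S.X₂ (hW.trans inf_le_right) (e j)) (by
        rw [map_sub, hg, sub_eq_zero]
        exact hd.symm)
    obtain ⟨c, hc⟩ := (ha W (hW.trans inf_le_left)).2 m'
    refine ⟨Sum.elim c d, ?_⟩
    dsimp only at hc ⊢
    rw [hsum]
    simp only [Sum.elim_inl, Sum.elim_inr]
    rw [hc, hm', sub_add_cancel]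

lemma isVectorBundle_of_isZero {E : Mods} (hE : IsZero E) : IsVectorBundle E := by
  refine isVectorBundle_of_frames fun x => ⟨⊤, trivial, PEmpty, inferInstance, PEmpty.elim,
    fun V hV => ?_⟩
  have : Subsingleton (Sec E V) := ⟨fun s t => by
    have h : ∀ s : Sec E V, s = 0 := fun s => by
      have := congrArg (fun f => app f V s) (hE.eq_of_src (𝟙 E) 0)
      exact this
    rw [h s, h t]⟩
  exact ⟨Function.injective_of_subsingleton _, fun s => ⟨0, Subsingleton.elim _ _⟩⟩

lemma IsVectorBundle.of_iso {E E' : Mods} (e : E ≅ E') (h : IsVectorBundle E) :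
    IsVectorBundle E' :=
  isVectorBundle_of_shortExact
    (S := ShortComplex.mk e.hom (cokernel.π e.hom) (cokernel.condition e.hom))
    { exact := ShortComplex.exact_cokernel e.hom } h
    (isVectorBundle_of_isZero (isZero_cokernel_of_epi e.hom))

lemma IsVectorBundle.biprod {E E' : Mods} (h : IsVectorBundle E) (h' : IsVectorBundle E') :
    IsVectorBundle (E ⊞ E') :=
  isVectorBundle_of_shortExact
    (ShortComplex.Splitting.ofHasBinaryBiproduct E E').shortExact h h'

end Extension

end Twistor

namespace Twistor

/-! ### The line bundles `𝒪(n)` -/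

section Charts

lemma apply_ne_zero_of_proj_eq {ℓ : ℂ × ℂ →L[ℂ] ℂ} {v w : PuncturedPlane} (hw : proj w = proj v)
    (h : ℓ v.1 ≠ 0) : ℓ w.1 ≠ 0 := by
  obtain ⟨c, hc⟩ := (Projectivization.mk_eq_mk_iff ℂ _ _ _ _).1 hw
  rw [← hc, Units.smul_def, map_smul, smul_eq_mul]
  exact mul_ne_zero c.ne_zero h

/-- The open subset of `ℙ¹` where a linear form does not vanish. -/
def chart (ℓ : ℂ × ℂ →L[ℂ] ℂ) : Opens (TopCat.of ProjLine) :=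
  ⟨{p | ∀ v : PuncturedPlane, proj v = p → ℓ v.1 ≠ 0}, by
    refine isOpen_coinduced.2 ?_
    have h : proj ⁻¹' {p | ∀ v : PuncturedPlane, proj v = p → ℓ v.1 ≠ 0} =
        {v : PuncturedPlane | ℓ v.1 ≠ 0} := by
      ext v
      refine ⟨fun h => h v rfl, fun h w hw => ?_⟩
      exact apply_ne_zero_of_proj_eq hw h
    rw [h]
    exact isOpen_ne_fun (ℓ.continuous.comp continuous_subtype_val) continuous_const⟩

lemma proj_mem_chart_iff {ℓ : ℂ × ℂ →L[ℂ] ℂ} {v : PuncturedPlane} :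
    proj v ∈ chart ℓ ↔ ℓ v.1 ≠ 0 :=
  ⟨fun h => h v rfl, fun h _ hw => apply_ne_zero_of_proj_eq hw h⟩

lemma coneSet_chart (ℓ : ℂ × ℂ →L[ℂ] ℂ) : coneSet (chart ℓ) = {v | ℓ v ≠ 0} := by
  ext v
  constructor
  · rintro ⟨v, rfl⟩
    exact proj_mem_chart_iff.1 v.2
  · intro h
    have hv : v ≠ 0 := by
      rintro rfl
      exact h (map_zero ℓ)
    exact ⟨⟨⟨v, hv⟩, proj_mem_chart_iff.2 h⟩, rfl⟩

lemma differentiableOn_zpow (ℓ : ℂ × ℂ →L[ℂ] ℂ) (n : ℤ) :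
    DifferentiableOn ℂ (fun v => ℓ v ^ n) {v | ℓ v ≠ 0} := fun v hv =>
  ((differentiableAt_zpow.2 (Or.inl hv)).comp v ℓ.differentiableAt).differentiableWithinAt

lemma coneSet_subset {U V : Opens (TopCat.of ProjLine)} (h : U ≤ V) : coneSet U ⊆ coneSet V := by
  rintro _ ⟨v, rfl⟩
  exact ⟨Cone.incl h v, rfl⟩

lemma apply_ne_zero_of_le_chart {ℓ : ℂ × ℂ →L[ℂ] ℂ} {U : Opens (TopCat.of ProjLine)}
    (h : U ≤ chart ℓ) (v : Cone U) : ℓ v.1.1 ≠ 0 :=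
  proj_mem_chart_iff.1 (h v.2)

/-- The section `ℓ ^ n` of `𝒪(n)` over the open subset where `ℓ` does not vanish. -/
noncomputable def zpowSection (ℓ : ℂ × ℂ →L[ℂ] ℂ) (n : ℤ) : Sec (twist n) (chart ℓ) :=
  show homogeneous n (chart ℓ) from ⟨fun v => ℓ v.1.1 ^ n,
    isHolo_of_eq (F := fun v => ℓ v ^ n)
      ((coneSet_chart ℓ).symm ▸ differentiableOn_zpow ℓ n) fun _ => rfl,
    fun c v => by
      change ℓ (c • v.1.1) ^ n = _
      rw [Units.smul_def, map_smul, smul_eq_mul, mul_zpow]⟩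

/-- The value of a section of `𝒪(n)` at a point of the cone. -/
def valueAt {n : ℤ} {U : Opens (TopCat.of ProjLine)} (s : Sec (twist n) U) (v : Cone U) : ℂ :=
  (show homogeneous n U from s).1 v

lemma valueAt_ext {n : ℤ} {U : Opens (TopCat.of ProjLine)} {s t : Sec (twist n) U}
    (h : ∀ v, valueAt s v = valueAt t v) : s = t :=
  Subtype.ext (funext h)

/-- The value of a regular function at a point of the cone. -/
def regularAt {U : Opens (TopCat.of ProjLine)} (c : structureSheaf.obj.obj (op U))
    (v : Cone U) : ℂ :=
  (show regular U from c).1 v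

lemma valueAt_smul {n : ℤ} {U : Opens (TopCat.of ProjLine)}
    (c : structureSheaf.obj.obj (op U)) (s : Sec (twist n) U) (v : Cone U) :
    valueAt (c • s) v = regularAt c v * valueAt s v := rfl

/-- The regular function `s / ℓ ^ n`. -/
noncomputable def divZpow (ℓ : ℂ × ℂ →L[ℂ] ℂ) (n : ℤ) {U : Opens (TopCat.of ProjLine)}
    (h : U ≤ chart ℓ) (s : Sec (twist n) U) : structureSheaf.obj.obj (op U) :=
  show regular U from ⟨fun v => valueAt s v * ℓ v.1.1 ^ (-n),
    isHolo_of_eq (F := fun v => extendByZero (valueAt s) v * ℓ v ^ (-n))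
      (s.2.1.mul ((differentiableOn_zpow ℓ (-n)).mono
        ((coneSet_subset h).trans (coneSet_chart ℓ).subset)))
      fun v => by rw [extendByZero_apply],
    fun c v => by
      change s.1 (v.smul c) * ℓ (c • v.1.1) ^ (-n) = 1 * (s.1 v * _)
      rw [s.2.2 c v, Units.smul_def, map_smul, smul_eq_mul, mul_zpow, one_mul,
        mul_mul_mul_comm, ← zpow_add₀ c.ne_zero, add_neg_cancel, zpow_zero, one_mul]⟩

lemma divZpow_smul (ℓ : ℂ × ℂ →L[ℂ] ℂ) (n : ℤ) {U : Opens (TopCat.of ProjLine)}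
    (h : U ≤ chart ℓ) (s : Sec (twist n) U) :
    (divZpow ℓ n h s •
      (res (twist n) h (zpowSection ℓ n) : Sec (twist n) U) : Sec (twist n) U) = s := by
  refine valueAt_ext fun v => ?_
  change valueAt s v * ℓ v.1.1 ^ (-n) * ℓ v.1.1 ^ n = valueAt s v
  rw [mul_assoc, ← zpow_add₀ (apply_ne_zero_of_le_chart h v), neg_add_cancel, zpow_zero, mul_one]

/-- The section `ℓ ^ n` is a frame of `𝒪(n)` where `ℓ` does not vanish. -/
lemma isFrame_zpowSection (ℓ : ℂ × ℂ →L[ℂ] ℂ) (n : ℤ) :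
    IsFrame (E := twist n) (U := chart ℓ) fun _ : Unit => zpowSection ℓ n := by
  intro V hV
  simp only [Fintype.sum_unique]
  constructor
  · intro c c' hc
    funext i
    refine Subtype.ext (funext fun v => ?_)
    have h1 := congrArg (fun s => valueAt s v) hc
    exact mul_right_cancel₀ (zpow_ne_zero n (apply_ne_zero_of_le_chart hV v)) h1
  · intro s
    exact ⟨fun _ => divZpow ℓ n hV s, divZpow_smul ℓ n hV s⟩

/-- One of the two coordinates of a nonzero vector does not vanish. -/
lemma fst_ne_zero_or_snd_ne_zero {v : ℂ × ℂ} (hv : v ≠ 0) :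
    ContinuousLinearMap.fst ℂ ℂ ℂ v ≠ 0 ∨ ContinuousLinearMap.snd ℂ ℂ ℂ v ≠ 0 := by
  by_contra! h
  exact hv (Prod.ext h.1 h.2)

lemma exists_proj_eq (p : ProjLine) : ∃ v : PuncturedPlane, proj v = p := by
  induction p using Projectivization.ind with
  | h v hv => exact ⟨⟨v, hv⟩, rfl⟩

lemma isVectorBundle_twist (n : ℤ) : IsVectorBundle (twist n) := by
  refine isVectorBundle_of_frames fun p => ?_
  obtain ⟨v, rfl⟩ := exists_proj_eq p
  obtain h | h := fst_ne_zero_or_snd_ne_zero v.2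
  · exact ⟨_, proj_mem_chart_iff.2 h, Unit, inferInstance, _, isFrame_zpowSection _ n⟩
  · exact ⟨_, proj_mem_chart_iff.2 h, Unit, inferInstance, _, isFrame_zpowSection _ n⟩

end Charts

end Twistor

namespace Twistor

/-! ### Homogeneous holomorphic functions on the punctured plane -/

section Liouville

open Filter Topology

variable {H : ℂ × ℂ → ℂ} {d : ℤ}

/-- Liouville's theorem along an affine line which avoids the origin: the values
`H (v + t w) = t ^ d * H (t⁻¹ v + w)` converge as `t` tends to infinity. -/
lemma eq_of_homogeneous (hH : DifferentiableOn ℂ H {0}ᶜ)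
    (hd : ∀ (c : ℂ) (v : ℂ × ℂ), c ≠ 0 → v ≠ 0 → H (c • v) = c ^ d * H v) (hd0 : d ≤ 0)
    {v w : ℂ × ℂ} (hw : w ≠ 0) (hvw : ∀ t : ℂ, v + t • w ≠ 0) :
    H v = if d = 0 then H w else 0 := by
  have hdiff : ∀ x : ℂ × ℂ, x ≠ 0 → DifferentiableAt ℂ H x := fun x hx =>
    hH.differentiableAt (isOpen_compl_singleton.mem_nhds hx)
  have hφ : Differentiable ℂ fun t : ℂ => H (v + t • w) := fun t =>
    (hdiff _ (hvw t)).comp t (by fun_prop)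
  have hinv : Tendsto (fun t : ℂ => t⁻¹) (cocompact ℂ) (𝓝 0) := by
    rw [← Metric.cobounded_eq_cocompact]
    exact tendsto_inv₀_cobounded
  have h1 : Tendsto (fun t : ℂ => H (t⁻¹ • v + w)) (cocompact ℂ) (𝓝 (H w)) := by
    refine (hdiff w hw).continuousAt.tendsto.comp ?_
    simpa using (hinv.smul_const v).add_const w
  have h2 : Tendsto (fun t : ℂ => t ^ d) (cocompact ℂ) (𝓝 (if d = 0 then 1 else 0)) := by
    split_ifs with h
    · simp [h]
    · obtain ⟨n, rfl⟩ : ∃ n : ℕ, d = -(n : ℤ) := ⟨d.natAbs, by lia⟩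
      have := hinv.pow n
      rw [zero_pow (by lia)] at this
      simpa using this
  have h3 : Tendsto (fun t : ℂ => H (v + t • w)) (cocompact ℂ)
      (𝓝 (if d = 0 then H w else 0)) := by
    have h4 := h2.mul h1
    rw [ite_mul, one_mul, zero_mul] at h4
    refine h4.congr' ?_
    have : ({0}ᶜ : Set ℂ) ∈ cocompact ℂ := isCompact_singleton.compl_mem_cocompact
    filter_upwards [this] with t ht
    have ht : t ≠ 0 := ht
    have e : t • (t⁻¹ • v + w) = v + t • w := by rw [smul_add, smul_inv_smul₀ ht]
    rw [← e, hd t _ ht]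
    intro h0
    exact hvw t (by rw [← e, h0, smul_zero])
  simpa using hφ.apply_eq_of_tendsto_cocompact 0 h3

lemma add_smul_ne_zero_of_fst {v : ℂ × ℂ} (hv : v.1 ≠ 0) (t : ℂ) : v + t • ((0, 1) : ℂ × ℂ) ≠ 0 :=
  fun h => hv (by simpa using congrArg Prod.fst h)

lemma add_smul_ne_zero_of_snd {v : ℂ × ℂ} (hv : v.2 ≠ 0) (t : ℂ) : v + t • ((1, 0) : ℂ × ℂ) ≠ 0 :=
  fun h => hv (by simpa using congrArg Prod.snd h)

lemma eq_zero_of_homogeneous_neg (hH : DifferentiableOn ℂ H {0}ᶜ)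
    (hd : ∀ (c : ℂ) (v : ℂ × ℂ), c ≠ 0 → v ≠ 0 → H (c • v) = c ^ d * H v) (hd0 : d < 0)
    {v : ℂ × ℂ} (hv : v ≠ 0) : H v = 0 := by
  obtain h | h := fst_ne_zero_or_snd_ne_zero hv
  · simpa [hd0.ne] using eq_of_homogeneous hH hd hd0.le (w := (0, 1)) (by simp)
      (add_smul_ne_zero_of_fst h)
  · simpa [hd0.ne] using eq_of_homogeneous hH hd hd0.le (w := (1, 0)) (by simp)
      (add_smul_ne_zero_of_snd h)

lemma eq_of_homogeneous_zero (hH : DifferentiableOn ℂ H {0}ᶜ)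
    (hd : ∀ (c : ℂ) (v : ℂ × ℂ), c ≠ 0 → v ≠ 0 → H (c • v) = c ^ (0 : ℤ) * H v)
    {v : ℂ × ℂ} (hv : v ≠ 0) : H v = H (1, 0) := by
  have h1 : H (1, 0) = H (0, 1) := by
    simpa using eq_of_homogeneous hH hd le_rfl (v := (1, 0)) (w := (0, 1)) (by simp)
      (add_smul_ne_zero_of_fst (by simp))
  obtain h | h := fst_ne_zero_or_snd_ne_zero hv
  · rw [h1]
    simpa using eq_of_homogeneous hH hd le_rfl (w := (0, 1)) (by simp)
      (add_smul_ne_zero_of_fst h)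
  · simpa using eq_of_homogeneous hH hd le_rfl (w := (1, 0)) (by simp)
      (add_smul_ne_zero_of_snd h)

end Liouville

/-! ### Morphisms between the line bundles `𝒪(n)` -/

section Hom

variable {a b : ℤ}

/-- A morphism `𝒪(a) ⟶ 𝒪(b)` is, where `ℓ` does not vanish, the multiplication by
the quotient by `ℓ ^ a` of the image of the section `ℓ ^ a`. -/
lemma valueAt_app (f : twist a ⟶ twist b) (ℓ : ℂ × ℂ →L[ℂ] ℂ) {U : Opens (TopCat.of ProjLine)}
    (s : Sec (twist a) U) (v : Cone U) (hv : ℓ v.1.1 ≠ 0) :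
    valueAt (app f U s) v =
      valueAt (app f _ (zpowSection ℓ a)) ⟨v.1, proj_mem_chart_iff.2 hv⟩ * ℓ v.1.1 ^ (-a) *
        valueAt s v := by
  have h1 : U ⊓ chart ℓ ≤ U := inf_le_left
  have h2 : U ⊓ chart ℓ ≤ chart ℓ := inf_le_right
  let v' : Cone (U ⊓ chart ℓ) := ⟨v.1, v.2, proj_mem_chart_iff.2 hv⟩
  have h : res (twist b) h1 (app f U s) =
      divZpow ℓ a h2 (res (twist a) h1 s) •
        (res (twist b) h2 (app f _ (zpowSection ℓ a)) : Sec (twist b) (U ⊓ chart ℓ)) := by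
    rw [← app_res, ← app_res, ← map_smul, divZpow_smul]
  -- Evaluation at `v`, considered as a point of the cone over the smaller open subset.
  have h' := congrArg (fun t => valueAt t v') h
  change valueAt (app f U s) v = (valueAt s v * ℓ v.1.1 ^ (-a)) * valueAt (app f _ _)
    ⟨v.1, proj_mem_chart_iff.2 hv⟩ at h'
  rw [h']
  ring

/-- Every morphism `𝒪(a) ⟶ 𝒪(b)` is the multiplication by a holomorphic function on `ℂ² ∖ {0}`
which is homogeneous of degree `b - a`. -/
lemma exists_multiplier (f : twist a ⟶ twist b) :
    ∃ H : ℂ × ℂ → ℂ, DifferentiableOn ℂ H {0}ᶜ ∧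
      (∀ (c : ℂ) (v : ℂ × ℂ), c ≠ 0 → v ≠ 0 → H (c • v) = c ^ (b - a) * H v) ∧
      ∀ (U : Opens (TopCat.of ProjLine)) (s : Sec (twist a) U) (v : Cone U),
        valueAt (app f U s) v = H v.1.1 * valueAt s v := by
  let g : (ℂ × ℂ →L[ℂ] ℂ) → ℂ × ℂ → ℂ := fun ℓ v =>
    extendByZero (valueAt (app f _ (zpowSection ℓ a))) v * ℓ v ^ (-a)
  have hg : ∀ ℓ (U : Opens (TopCat.of ProjLine)) (s : Sec (twist a) U) (v : Cone U),
      ℓ v.1.1 ≠ 0 → valueAt (app f U s) v = g ℓ v.1.1 * valueAt s v := by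
    intro ℓ U s v hv
    rw [valueAt_app f ℓ s v hv]
    congr 2
    exact (extendByZero_apply _ (⟨v.1, proj_mem_chart_iff.2 hv⟩ : Cone (chart ℓ))).symm
  have hgg : ∀ ℓ ℓ' (v : ℂ × ℂ), ℓ v ≠ 0 → ℓ' v ≠ 0 → g ℓ v = g ℓ' v := by
    intro ℓ ℓ' v hv hv'
    have h0 : v ≠ 0 := by rintro rfl; exact hv (map_zero ℓ)
    let v' : Cone (chart ℓ) := ⟨⟨v, h0⟩, proj_mem_chart_iff.2 hv⟩
    have h := (hg ℓ _ (zpowSection ℓ a) v' hv).symm.trans (hg ℓ' _ (zpowSection ℓ a) v' hv')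
    exact mul_right_cancel₀ (zpow_ne_zero a hv) h
  have hgd : ∀ ℓ (v : ℂ × ℂ), ℓ v ≠ 0 → DifferentiableAt ℂ (g ℓ) v := by
    intro ℓ v hv
    have ho : {v : ℂ × ℂ | ℓ v ≠ 0} ∈ nhds v := by
      rw [← coneSet_chart]
      exact (isOpen_coneSet _).mem_nhds (by rw [coneSet_chart]; exact hv)
    have h1 : DifferentiableOn ℂ (extendByZero (valueAt (app f _ (zpowSection ℓ a))))
        (coneSet (chart ℓ)) := (app f _ (zpowSection ℓ a)).2.1
    rw [coneSet_chart] at h1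
    exact (h1.mul (differentiableOn_zpow ℓ (-a))).differentiableAt ho
  have hgh : ∀ ℓ (c : ℂ) (v : ℂ × ℂ), c ≠ 0 → ℓ v ≠ 0 → g ℓ (c • v) = c ^ (b - a) * g ℓ v := by
    intro ℓ c v hc hv
    have h0 : v ≠ 0 := by rintro rfl; exact hv (map_zero ℓ)
    let v' : Cone (chart ℓ) := ⟨⟨v, h0⟩, proj_mem_chart_iff.2 hv⟩
    have h1 := (app f _ (zpowSection ℓ a)).2.2 (Units.mk0 c hc) v'
    have h2 := extendByZero_apply (valueAt (app f _ (zpowSection ℓ a))) v'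
    have h3 := extendByZero_apply (valueAt (app f _ (zpowSection ℓ a)))
      (v'.smul (Units.mk0 c hc))
    change extendByZero _ (c • v) * ℓ (c • v) ^ (-a) = _ * (extendByZero _ v * _)
    refine (congrArg₂ (· * ·) (h3.trans h1) rfl).trans ?_
    rw [h2, map_smul, smul_eq_mul, mul_zpow, sub_eq_add_neg, zpow_add₀ hc]
    simp only [Units.val_mk0]
    exact mul_mul_mul_comm _ _ _ _
  -- The functions `g ℓ` agree where they are meaningful, so those of the two coordinates glue.
  let H : ℂ × ℂ → ℂ := fun v => if v.1 ≠ 0 then g (ContinuousLinearMap.fst ℂ ℂ ℂ) v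
    else g (ContinuousLinearMap.snd ℂ ℂ ℂ) v
  have hH1 : ∀ v : ℂ × ℂ, v.1 ≠ 0 → H v = g (ContinuousLinearMap.fst ℂ ℂ ℂ) v :=
    fun v hv => if_pos hv
  have hH2 : ∀ v : ℂ × ℂ, v.2 ≠ 0 → H v = g (ContinuousLinearMap.snd ℂ ℂ ℂ) v := by
    intro v hv
    by_cases h : v.1 ≠ 0
    · exact (hH1 v h).trans (hgg _ _ v h hv)
    · exact if_neg h
  have hH : ∀ v : ℂ × ℂ, v ≠ 0 → ∃ ℓ : ℂ × ℂ →L[ℂ] ℂ, ℓ v ≠ 0 ∧ ∀ w, ℓ w ≠ 0 → H w = g ℓ w := by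
    intro v hv
    obtain h | h := fst_ne_zero_or_snd_ne_zero hv
    · exact ⟨_, h, hH1⟩
    · exact ⟨_, h, hH2⟩
  refine ⟨H, fun v hv => ?_, fun c v hc hv => ?_, fun U s v => ?_⟩
  · obtain ⟨ℓ, hℓ, h⟩ := hH v hv
    refine ((hgd ℓ v hℓ).congr_of_eventuallyEq ?_).differentiableWithinAt
    filter_upwards [(isOpen_ne_fun ℓ.continuous continuous_const).mem_nhds hℓ] with w hw
    exact h w hw
  · obtain ⟨ℓ, hℓ, h⟩ := hH v hv
    rw [h v hℓ, h (c • v) (by simpa using ⟨hc, hℓ⟩), hgh ℓ c v hc hℓ]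
  · obtain ⟨ℓ, hℓ, h⟩ := hH v.1.1 v.1.2
    rw [h _ hℓ, hg ℓ U s v hℓ]

lemma hom_ext_app {E E' : Mods} {f g : E ⟶ E'} (h : ∀ U s, app f U s = app g U s) : f = g := by
  ext U s
  exact h U.unop s

/-- There are no nonzero morphisms `𝒪(a) ⟶ 𝒪(b)` for `b < a`. -/
lemma twist_hom_eq_zero (h : b < a) (f : twist a ⟶ twist b) : f = 0 := by
  obtain ⟨H, hH, hd, hf⟩ := exists_multiplier f
  refine hom_ext_app fun U s => valueAt_ext fun v => ?_
  rw [hf, eq_zero_of_homogeneous_neg hH hd (by lia) v.1.2, zero_mul]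
  rfl

/-- The endomorphisms of `𝒪(w)` are the scalars. -/
lemma exists_valueAt_app_eq_mul {w : ℤ} (f : twist w ⟶ twist w) :
    ∃ k : ℂ, ∀ (U : Opens (TopCat.of ProjLine)) (s : Sec (twist w) U) (v : Cone U),
      valueAt (app f U s) v = k * valueAt s v := by
  obtain ⟨H, hH, hd, hf⟩ := exists_multiplier f
  rw [sub_self] at hd
  exact ⟨H (1, 0), fun U s v => by rw [hf, eq_of_homogeneous_zero hH hd v.1.2]⟩

/-- A constant function, as a regular function. -/
def constRegular (k : ℂ) (U : Opens (TopCat.of ProjLine)) : structureSheaf.obj.obj (op U) :=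
  show regular U from ⟨fun _ => k, isHolo_of_eq (differentiableOn_const k) fun _ => rfl,
    fun c v => by simp⟩

/-- A nonzero endomorphism of `𝒪(w)` is an isomorphism. -/
lemma isIso_of_ne_zero {w : ℤ} (f : twist w ⟶ twist w) (h : f ≠ 0) : IsIso f := by
  obtain ⟨k, hk⟩ := exists_valueAt_app_eq_mul f
  have hk0 : k ≠ 0 := by
    rintro rfl
    refine h (hom_ext_app fun U s => valueAt_ext fun v => ?_)
    rw [hk, zero_mul]
    rfl
  refine isIso_of_bijective_app f fun U => ⟨fun s t hst => valueAt_ext fun v => ?_, fun t => ?_⟩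
  · have h1 : app f U.unop s = app f U.unop t := hst
    have h2 := congrArg (fun t => valueAt t v) h1
    simp only [hk] at h2
    exact mul_left_cancel₀ hk0 h2
  · refine ⟨(constRegular k⁻¹ U.unop • t : Sec (twist w) U.unop), valueAt_ext fun v => ?_⟩
    refine (hk U.unop _ v).trans ?_
    rw [valueAt_smul]
    exact mul_inv_cancel_left₀ hk0 _

end Hom

end Twistor

namespace Twistor

/-! ### Mixed twistor complexes -/

section Mixed

lemma isPure_iff_isFinitePower {E : Mods} {w : ℤ} : IsPure E w ↔ IsFinitePower (twist w) E :=
  IsFinitePower.iff_exists_iso.symm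

lemma IsPure.isVectorBundle {E : Mods} {w : ℤ} (h : IsPure E w) : IsVectorBundle E := by
  have h' := isPure_iff_isFinitePower.1 h
  clear h
  induction h' with
  | zero h => exact isVectorBundle_of_isZero h
  | succ e _ ih =>
    exact ((isVectorBundle_twist w).biprod ih).of_iso e.symm

/-- The graded pieces of a shifted filtration. -/
lemma nonempty_gr_shiftFiltration_iso {C : Type*} [Category* C] [Abelian C] {X : C}
    (F : ℤ →o Subobject X) (i n : ℤ) : Nonempty (gr (shiftFiltration F i) n ≅ gr F (n - i)) := by
  have h : ∀ k m (hk : k ≤ m), k = m - 1 →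
      Nonempty (cokernel (Subobject.ofLE (F k) (F m) (F.monotone hk)) ≅ gr F m) := by
    rintro _ m _ rfl
    exact ⟨Iso.refl _⟩
  exact h (n - 1 - i) (n - i) (by lia) (by lia)

variable {M : CochainComplex Mods ℤ} {W : ℤ →o Subobject M}

/-- From the page `E₃` on, the row `q` of the spectral sequence is pure of weight `q`. -/
lemma IsMixedTwistorComplex.isFinitePower_page (hM : IsMixedTwistorComplex M W) (r : ℤ)
    (hr : 3 ≤ r) (pq : ℤ × ℤ) :
    IsFinitePower (twist pq.2) (((filteredSpectralSequence W).page r (two_le_of_three_le hr)).X pq) := by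
  refine page_weight (filteredSpectralSequence W) (fun w X => IsFinitePower (twist w) X)
    (fun w X Y e h => h.of_iso e.symm)
    (fun w S h₁ h₂ h₃ => IsFinitePower.homology isIso_of_ne_zero S h₁ h₂ h₃)
    (fun w w' X Y hw hX hY f => hX.hom_eq_zero (twist_hom_eq_zero hw) hY f) ?_ r hr pq
  rintro ⟨p, q⟩
  have h := isPure_iff_isFinitePower.1 (hM.pure (-p) (p + q))
  rw [neg_add_cancel_left] at h
  exact h.of_iso (filteredSpectralSequenceE₂Iso W p q)

lemma IsMixedTwistorComplex.d_eq_zero (hM : IsMixedTwistorComplex M W) (r : ℤ) (hr : 3 ≤ r)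
    (pq pq' : ℤ × ℤ) : ((filteredSpectralSequence W).page r (two_le_of_three_le hr)).d pq pq' = 0 :=
  page_d_eq_zero_of_weight (filteredSpectralSequence W)
    (fun w X => IsFinitePower (twist w) X)
    (fun _ _ _ _ hw hX hY f => hX.hom_eq_zero (twist_hom_eq_zero hw) hY f) r hr
    (hM.isFinitePower_page r hr) pq pq'

/-- `Gr_m Hⁱ(M)` is an entry in the row `i + m`. -/
lemma IsMixedTwistorComplex.isPure_gr_inducedFiltration (hM : IsMixedTwistorComplex M W)
    (i m : ℤ) : IsPure (gr (inducedFiltration W i) m) (i + m) := by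
  obtain ⟨r, hr, ⟨e⟩⟩ := exists_gr_inducedFiltration_iso_page W hM.finite i m
  exact isPure_iff_isFinitePower.2 ((hM.isFinitePower_page r hr (-m, i + m)).of_iso e)

lemma IsMixedTwistorComplex.isVectorBundle_homology (hM : IsMixedTwistorComplex M W) (i : ℤ) :
    IsVectorBundle (M.homology i) := by
  obtain ⟨a, ha⟩ := exists_isZero_inducedFiltration W hM.finite i
  obtain ⟨b, hb⟩ := exists_inducedFiltration_eq_top W hM.finite i
  have h := subobject_mem_of_gr (inducedFiltration W i) IsVectorBundle
    (fun _ => isVectorBundle_of_isZero) (fun _ => isVectorBundle_of_shortExact) ha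
    (fun m => (hM.isPure_gr_inducedFiltration i m).isVectorBundle) b
  have := (Subobject.isIso_arrow_iff_eq_top _).2 hb
  exact h.of_iso (asIso (inducedFiltration W i b).arrow)

lemma IsMixedTwistorComplex.isStrictSubbundle (hM : IsMixedTwistorComplex M W) (i n : ℤ) :
    IsStrictSubbundle (inducedFiltration W i n) := by
  obtain ⟨a, ha⟩ := exists_isZero_inducedFiltration W hM.finite i
  obtain ⟨b, hb⟩ := exists_inducedFiltration_eq_top W hM.finite i
  have hgr := fun m => (hM.isPure_gr_inducedFiltration i m).isVectorBundle
  exact ⟨subobject_mem_of_gr _ IsVectorBundle (fun _ => isVectorBundle_of_isZero)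
      (fun _ => isVectorBundle_of_shortExact) ha hgr n,
    cokernel_arrow_mem_of_gr _ IsVectorBundle (fun _ => isVectorBundle_of_isZero)
      (fun _ => isVectorBundle_of_shortExact) hb hgr n⟩

lemma IsMixedTwistorComplex.isMixedTwistorStructure (hM : IsMixedTwistorComplex M W) (i : ℤ) :
    IsMixedTwistorStructure (M.homology i) (shiftFiltration (inducedFiltration W i) i) where
  isVectorBundle := hM.isVectorBundle_homology i
  strict n := hM.isStrictSubbundle i (n - i)
  eventually_zero := by
    obtain ⟨a, ha⟩ := exists_isZero_inducedFiltration W hM.finite i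
    refine ⟨a + i, ?_⟩
    change IsZero (inducedFiltration W i (a + i - i) : Mods)
    rwa [add_sub_cancel_right]
  eventually_all := by
    obtain ⟨b, hb⟩ := exists_inducedFiltration_eq_top W hM.finite i
    refine ⟨b + i, ?_⟩
    change inducedFiltration W i (b + i - i) = ⊤
    rwa [add_sub_cancel_right]
  pure n := by
    obtain ⟨e⟩ := nonempty_gr_shiftFiltration_iso (inducedFiltration W i) i n
    have h := hM.isPure_gr_inducedFiltration i (n - i)
    rw [add_sub_cancel] at h
    exact isPure_iff_isFinitePower.2 ((isPure_iff_isFinitePower.1 h).of_iso e)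

end Mixed

end Twistor
theorem mainTheorem7
    (M : CochainComplex Twistor.Mods ℤ) (W : ℤ →o Subobject M)
    (hM : Twistor.IsMixedTwistorComplex M W) :
    (∀ (r : ℤ) (hr : 3 ≤ r) (pq pq' : ℤ × ℤ),
      ((Twistor.filteredSpectralSequence W).page r (by lia)).d pq pq' = 0) ∧
    ∀ i : ℤ,
      Twistor.IsVectorBundle (M.homology i) ∧
      Twistor.IsMixedTwistorStructure (M.homology i)
        (Twistor.shiftFiltration (Twistor.inducedFiltration W i) i) :=
  ⟨fun r hr pq pq' => hM.d_eq_zero r hr pq pq',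
    fun i => ⟨hM.isVectorBundle_homology i, hM.isMixedTwistorStructure i⟩⟩
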